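/- Let $s\in(0,1)$ and $\theta=2^{-1/s}\in(0,\tfrac12)$. \emph{Cantor set.} Put $E_0=[0,1]$. For $n\ge 0$, $E_n$ is the union of $2^n$ disjoint closed segments of length $\theta^n$, and $E_{n+1}$ is obtained from $E_n$ by removing from each of them the concentric open segment of length $(1-2\theta)\theta^n$. For $m\ge1$ let $I_{m,k}=(a_{m,k}-r_m,a_{m,k}+r_m)$, $1\le k\le 2^{m-1}$, with $r_m=\frac12(1-2\theta)\theta^{m-1}$, be the open segments removed from $E_{m-1}$ (so $a_{m,k}$ is the midpoint of the $k$-th segment of $E_{m-1}$). Let $K(\theta)=\bigcap_{n\ge0}E_n$, $$\Omega(\theta)=\bigcup_{m\ge1}\bigcup_{k=1}^{2^{m-1}}(a_{m,k}-\theta r_m,a_{m,k}+\theta r_m),\qquad \tilde K(\theta)=[0,1]\setminus\Omega(\theta).$$ \emph{Dynamics.} Let $\Phi_t(x,\xi)=(x+t\xi,\xi)$ on $\mathbf R\times\mathbf R$, and let $U:\mathbf R\to\mathbf R$ be given by $U(y)=\frac1\theta\mathcal L^1(\Omega(\theta)\cap(0,y))-y$ for $y\in[0,1]$ and $U(y)=0$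 for $y\notin[0,1]$. Let $F_t(y)$ denote the first component of $\Phi_t(y,U(y))$. Let $\rho^{in}=\frac1{1-\theta}\mathbf 1_{\tilde K(\theta)}$, let $\mu^{in}=\rho^{in}(x)\,dx\,\delta_{U(x)}(d\xi)$ be the image of $\rho^{in}\mathcal L^1$ under $x\mapsto(x,U(x))$, let $\mu(t)=\Phi_t\#\mu^{in}$, and let $\rho(t)=\Pi\#\mu(t)$ with $\Pi(x,\xi)=x$. Let $E$ be the set of points where $U$ is not differentiable, $Z_t=\{y\notin E: F_t'(y)=0\}$, and let the caustic fibre be $C_t=\{x: F_t^{-1}(\{x\})\cap(Z_t\cup E)\ne\emptyset\}$. $\mathcal H^s$ is the Hausdorff measure normalized by coverings with weights $\sum_i(\operatorname{diam}A_i)^s$. Then $\Phi_t$ is the Hamiltonian flow of $H(x,\xi)=\frac12\xi^2$, $U$ is Lipschitz on $\mathbf R$ with $\operatorname{supp}U\subset[0,1]$, $F_t(y)=y+tU(y)$ for all $t,y\in\mathbf R$, and: (a) $F_1$ is (strictly) increasing on $(-\infty,0)\cup\Omega(\theta)\cup(1,+\infty)$ and nondecreasing on $\mathbf R$; (b) $F_1((-\infty,0)\cup\Omega(\theta)\cup(1,+\infty))=\mathbf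 R\setminus K(\theta)$ and $F_1(\tilde K(\theta))=K(\theta)$; (c) $$\mu(1)=\frac1{1-\theta}\sum_{m\ge1}\sum_{k=1}^{2^{m-1}}\left(\delta_{a_{m,k}-r_m}\otimes\mathbf 1_{(-(1-\theta)r_m,0)}\mathcal L^1+\delta_{a_{m,k}+r_m}\otimes\mathbf 1_{(0,(1-\theta)r_m)}\mathcal L^1\right);$$ (d) $$\rho(1)=F_1\#(\rho^{in}\mathcal L^1)=\tfrac12(1-2\theta)\sum_{m\ge1}\theta^{m-1}\sum_{k=1}^{2^{m-1}}\left(\delta_{a_{m,k}-r_m}+\delta_{a_{m,k}+r_m}\right),$$ so that $\rho(1)(\mathbf R)=1$, $\operatorname{supp}\rho(1)=K(\theta)$, and $\rho(1)\perp\mathcal L^1$; (e) $C_1\cap(0,1)=K(\theta)\cap(0,1)$, $\mathcal H^s(C_1)=\mathcal H^s(K(\theta))=1$ and $s=\ln2/\ln(1/\theta)$; in particular $C_1$ and $\operatorname{supp}\rho(1)$ have Hausdorff dimension $s$, where $s\in(0,1)$ is arbitrary. -/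

import Mathlib

open Set MeasureTheory
open scoped NNReal ENNReal MeasureTheory

noncomputable section

namespace CantorCaustic

/-! ### Classical dynamics on the phase space `ℝ × ℝ` and monokinetic measures -/

/-- `Φ` is a global flow of Hamilton's equations `x' = ∂H/∂ξ`, `ξ' = -∂H/∂x` on `ℝ × ℝ`. -/
def IsHamiltonianFlow (H : ℝ → ℝ → ℝ) (Φ : ℝ → ℝ × ℝ → ℝ × ℝ) : Prop :=
  ∀ z : ℝ × ℝ, Φ 0 z = z ∧ ∀ t : ℝ,
    HasDerivAt (fun τ => Φ τ z)
      (deriv (fun ξ => H (Φ t z).1 ξ) (Φ t z).2, -deriv (fun x => H x (Φ t z).2) (Φ t z).1) t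

/-- The free Hamiltonian `H(x, ξ) = ξ² / 2`. -/
def freeHamiltonian (_x ξ : ℝ) : ℝ := ξ ^ 2 / 2

/-- The free flow `Φ_t(x, ξ) = (x + t ξ, ξ)`. -/
def freeFlow (t : ℝ) (z : ℝ × ℝ) : ℝ × ℝ := (z.1 + t * z.2, z.2)

/-- The monokinetic measure with (continuous) momentum profile `U` and density `ρ`, that is
`ρ(x) dx ⊗ δ_{U(x)}(dξ)`: the image of `ρ(x) dx` under `x ↦ (x, U x)`. -/
def monokinetic (U ρ : ℝ → ℝ) : Measure (ℝ × ℝ) :=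
  Measure.map (fun x => (x, U x)) (volume.withDensity fun x => ENNReal.ofReal (ρ x))

/-- The measure `μ(t) = Φ_t # μ^in` transported along the flow `Φ`. -/
def transported (Φ : ℝ → ℝ × ℝ → ℝ × ℝ) (μin : Measure (ℝ × ℝ)) (t : ℝ) : Measure (ℝ × ℝ) :=
  Measure.map (Φ t) μin

/-- The map `F_t : y ↦ X_t(y, U(y))`, where `Φ_t = (X_t, Ξ_t)`. -/
def flowMap (Φ : ℝ → ℝ × ℝ → ℝ × ℝ) (U : ℝ → ℝ) (t y : ℝ) : ℝ := (Φ t (y, U y)).1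

/-- The set `E` of points at which the momentum profile `U` is not differentiable. -/
def nondiffSet (U : ℝ → ℝ) : Set ℝ := {y | ¬ DifferentiableAt ℝ U y}

/-- The set `Z_t` of points of `ℝ \ E` at which the Jacobian `J_t = |F_t'|` vanishes. -/
def zeroJacobianSet (Φ : ℝ → ℝ × ℝ → ℝ × ℝ) (U : ℝ → ℝ) (t : ℝ) : Set ℝ :=
  {y | y ∉ nondiffSet U ∧ |deriv (flowMap Φ U t) y| = 0}

/-- The caustic fibre `C_t`: all `x` such that `F_t⁻¹({x})` meets `Z_t ∪ E`. -/
def causticFibre (Φ : ℝ → ℝ × ℝ → ℝ × ℝ) (U : ℝ → ℝ) (t : ℝ) : Set ℝ :=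
  {x | (flowMap Φ U t ⁻¹' {x} ∩ (zeroJacobianSet Φ U t ∪ nondiffSet U)).Nonempty}

/-! ### The generalized Cantor set

The stage `E_n` consists of `2 ^ n` closed segments of length `θ ^ n`, numbered from left to right
by `k = 0, …, 2 ^ n - 1`. The open segments removed from `E_n` are numbered by the same `k`. -/

/-- Left endpoint of the `k`-th segment of `E_n`, `0 ≤ k < 2 ^ n`. The segment number `j` of `E_n`
contains the segments number `2 j` (sharing its left endpoint) and `2 j + 1` (sharing its right
endpoint) of `E_{n+1}`. -/
def leftEnd (θ : ℝ) : ℕ → ℕ → ℝ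
  | 0, _ => 0
  | n + 1, k => leftEnd θ n (k / 2) + (if k % 2 = 0 then 0 else (1 - θ) * θ ^ n)

/-- Midpoint of the `k`-th segment of `E_n`; it is the midpoint of the open segment removed
from it. -/
def center (θ : ℝ) (n k : ℕ) : ℝ := leftEnd θ n k + θ ^ n / 2

/-- Half of the length `(1 - 2θ) θ ^ n` of the open segments removed from `E_n`. -/
def radius (θ : ℝ) (n : ℕ) : ℝ := (1 / 2) * (1 - 2 * θ) * θ ^ n

/-- The open segment removed from the center of the `k`-th segment of `E_n`. -/
def gap (θ : ℝ) (n k : ℕ) : Set ℝ :=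
  Ioo (center θ n k - radius θ n) (center θ n k + radius θ n)

/-- The stages `E_n` of the construction. -/
def stage (θ : ℝ) : ℕ → Set ℝ
  | 0 => Icc 0 1
  | n + 1 => stage θ n \ ⋃ k ∈ Finset.range (2 ^ n), gap θ n k

/-- The generalized Cantor set `K(θ)`. -/
def cantor (θ : ℝ) : Set ℝ := ⋂ n, stage θ n

/-- The open set `Ω(θ)`: each removed segment is shrunk by the factor `θ` around its center. -/
def omegaSet (θ : ℝ) : Set ℝ :=
  ⋃ n : ℕ, ⋃ k ∈ Finset.range (2 ^ n),
    Ioo (center θ n k - θ * radius θ n) (center θ n k + θ * radius θ n)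

/-- The set `K̃(θ) = [0, 1] \ Ω(θ)`. -/
def cantorTilde (θ : ℝ) : Set ℝ := Icc 0 1 \ omegaSet θ

/-- The initial momentum profile: `U(y) = θ⁻¹ |Ω(θ) ∩ (0, y)| - y` on `[0, 1]`, and `0` elsewhere. -/
def profile (θ : ℝ) (y : ℝ) : ℝ :=
  open Classical in
  if y ∈ Icc (0 : ℝ) 1 then (1 / θ) * volume.real (omegaSet θ ∩ Ioo 0 y) - y else 0

/-- The initial density `(1 - θ)⁻¹ 1_{K̃(θ)}`. -/
def density (θ : ℝ) : ℝ → ℝ := (cantorTilde θ).indicator fun _ => 1 / (1 - θ)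

/-- The initial phase space measure `μ^in`. -/
def muIn (θ : ℝ) : Measure (ℝ × ℝ) := monokinetic (profile θ) (density θ)

/-- The phase space measure `μ(t)` at time `t`. -/
def mu (θ t : ℝ) : Measure (ℝ × ℝ) := transported freeFlow (muIn θ) t

/-- The first marginal `ρ(t)` of `μ(t)`. -/
def rho (θ t : ℝ) : Measure ℝ := Measure.map Prod.fst (mu θ t)

/-- The map `F_t`. -/
def F (θ t : ℝ) : ℝ → ℝ := flowMap freeFlow (profile θ) t

/-- The caustic fibre `C_t`. -/
def caustic (θ t : ℝ) : Set ℝ := causticFibre freeFlow (profile θ) t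

/-! ### The stages are unions of `2 ^ n` disjoint segments of length `θ ^ n` -/

theorem leftEnd_sep {θ : ℝ} (h0 : 0 < θ) (h1 : θ < 1 / 2) (n : ℕ) :
    ∀ j k : ℕ, j < k → k < 2 ^ n → leftEnd θ n j + θ ^ n < leftEnd θ n k := by
  induction n with
  | zero => intro j k hjk hk; simp at hk; omega
  | succ n ih =>
    intro j k hjk hk
    have hp : 0 < θ ^ n := pow_pos h0 n
    have e : θ ^ (n + 1) = θ * θ ^ n := pow_succ' θ n
    have hk2 : k / 2 < 2 ^ n := by rw [pow_succ] at hk; omega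
    have hm : θ * θ ^ n < (1 / 2) * θ ^ n := mul_lt_mul_of_pos_right h1 hp
    simp only [leftEnd, e]
    rcases Nat.lt_or_ge (j / 2) (k / 2) with h | h
    · have := ih _ _ h hk2
      split_ifs <;> nlinarith
    · have h2 : j / 2 = k / 2 := by omega
      have h3 : j % 2 = 0 := by omega
      have h4 : ¬ k % 2 = 0 := by omega
      rw [h2, if_pos h3, if_neg h4]
      nlinarith

theorem stage_eq {θ : ℝ} (h0 : 0 < θ) (h1 : θ < 1 / 2) (n : ℕ) :
    stage θ n = ⋃ k ∈ Finset.range (2 ^ n), Icc (leftEnd θ n k) (leftEnd θ n k + θ ^ n) := by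
  induction n with
  | zero => simp [stage, leftEnd]
  | succ n ih =>
    have hp : 0 < θ ^ n := pow_pos h0 n
    have e : θ ^ (n + 1) = θ * θ ^ n := pow_succ' θ n
    have hm : θ * θ ^ n < (1 / 2) * θ ^ n := mul_lt_mul_of_pos_right h1 hp
    have hq : 0 < θ * θ ^ n := mul_pos h0 hp
    ext x
    simp only [stage, ih, mem_sdiff, mem_iUnion, Finset.mem_range, mem_Icc, exists_prop, gap,
      center, radius, mem_Ioo, not_exists, not_and, not_lt]
    constructor
    · rintro ⟨⟨k, hk, hx1, hx2⟩, hx⟩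
      by_cases hc : x ≤ leftEnd θ n k + θ * θ ^ n
      · refine ⟨2 * k, by rw [pow_succ]; omega, ?_⟩
        have a1 : 2 * k / 2 = k := by omega
        have a2 : 2 * k % 2 = 0 := by omega
        simp only [leftEnd, a1, a2, if_true, e]
        constructor <;> linarith
      · have := hx k hk (by push Not at hc; linarith)
        refine ⟨2 * k + 1, by rw [pow_succ]; omega, ?_⟩
        have a1 : (2 * k + 1) / 2 = k := by omega
        have a2 : ¬ (2 * k + 1) % 2 = 0 := by omega
        simp only [leftEnd, a1, a2, if_false, e]
        constructor <;> linarith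
    · rintro ⟨k, hk, hx1, hx2⟩
      have hk2 : k / 2 < 2 ^ n := by rw [pow_succ] at hk; omega
      simp only [leftEnd, e] at hx1 hx2
      have hin : leftEnd θ n (k / 2) ≤ x ∧ x ≤ leftEnd θ n (k / 2) + θ ^ n := by
        split_ifs at hx1 hx2 <;> constructor <;> linarith
      refine ⟨⟨k / 2, hk2, hin⟩, ?_⟩
      intro j hj hxj
      rcases lt_trichotomy j (k / 2) with h | h | h
      · have := leftEnd_sep h0 h1 n _ _ h hk2
        linarith [hin.1]
      · subst h
        split_ifs at hx1 hx2 <;> linarith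
      · have := leftEnd_sep h0 h1 n _ _ h hj
        linarith [hin.2]

end CantorCaustic

end

open CantorCaustic

/-!
# Density concentration on a Cantor set

Everything follows from an explicit description of `F_1 = id + U`. On `[0, 1]` it is
`y ↦ θ⁻¹ |Ω(θ) ∩ (0, y)|`. The set `[0, 1] \ K(θ)` is the disjoint union of the gaps, `K(θ)` is
null, and `Ω(θ)` takes the proportion `θ` of every gap; a point of `K(θ)` never lies inside a gap,
hence `F_1 = id` on `K(θ)` (`F_one_of_mem_cantor`). On a gap `(a - r, a + r)` the map is constant to
the left and to the right of the core `(a - θ r, a + θ r)` and maps the core affinely onto the gap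
(`F_one_core_left`, `F_one_core`, `F_one_core_right`). Monotonicity and the images of `Ω(θ)` and
`K̃(θ)` can be read off from this.

Up to the null set `K(θ)`, the set `K̃(θ)` consists of the parts of the gaps outside the cores. On
each of them `F_1` is a constant `c` and `U(y) = c - y`, so that `μ^in` is moved to Lebesgue measure
on a vertical segment over `c` (`restrict_cantorTilde`, `map_leftPart`, `map_rightPart`). The
endpoints of the gaps are dense in the closed null set `K(θ)`; this gives the support and the
singularity of `ρ(1)`.

The caustic fibre equals `K(θ)`: off `K̃(θ)` the map is locally affine with nonzero slope, and at a
point of `K(θ)` the profile, which vanishes at the centers of the gaps but is of size `θ ^ n` at the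
ends of the cores of generation `n`, is not differentiable (`not_differentiableAt_profile`).

For `H^s(K(θ)) ≤ 1` one covers by the segments of the stages, as `2 ^ n (θ ^ n) ^ s = 1`. For the
lower bound, the Cantor function of `K(θ)` maps `K(θ)` onto `[0, 1]` and is `s`-Hölder with constant
exactly `1` (`exists_cantorFunction`). The constant passes through the self-similar construction
thanks to `u ^ s + v ^ s ≤ (u + v + 1 - 2θ) ^ s` for `0 ≤ u, v ≤ θ`, a consequence of the concavity
of `t ↦ t ^ s` and of `θ ^ s = 1 / 2` (`rpow_add_rpow_le`).
-/

namespace CantorCaustic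

variable {s θ : ℝ} {n m k j : ℕ}

/-! ### Geometry of the stages and of the gaps -/

lemma leftEnd_two_mul (θ : ℝ) (n k : ℕ) : leftEnd θ (n + 1) (2 * k) = leftEnd θ n k := by
  simp [leftEnd]

lemma leftEnd_two_mul_add_one (θ : ℝ) (n k : ℕ) :
    leftEnd θ (n + 1) (2 * k + 1) = leftEnd θ n k + (1 - θ) * θ ^ n := by
  have h : (2 * k + 1) / 2 = k := by omega
  simp [leftEnd, h]

lemma center_sub_radius (θ : ℝ) (n k : ℕ) :
    center θ n k - radius θ n = leftEnd θ (n + 1) (2 * k) + θ ^ (n + 1) := by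
  rw [leftEnd_two_mul, center, radius]; ring

lemma center_add_radius (θ : ℝ) (n k : ℕ) :
    center θ n k + radius θ n = leftEnd θ (n + 1) (2 * k + 1) := by
  rw [leftEnd_two_mul_add_one, center, radius]; ring

lemma radius_pos (h0 : 0 < θ) (h1 : θ < 1 / 2) (n : ℕ) : 0 < radius θ n := by
  have := pow_pos h0 n
  unfold radius
  have : 0 < 1 - 2 * θ := by linarith
  positivity

lemma theta_mul_radius_lt (h0 : 0 < θ) (h1 : θ < 1 / 2) (n : ℕ) :
    θ * radius θ n < radius θ n := by
  nlinarith [radius_pos h0 h1 n]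

lemma stage_antitone (θ : ℝ) : Antitone (stage θ) :=
  antitone_nat_of_succ_le fun _ => sdiff_subset

lemma Icc_leftEnd_subset_stage (h0 : 0 < θ) (h1 : θ < 1 / 2) (hk : k < 2 ^ n) :
    Icc (leftEnd θ n k) (leftEnd θ n k + θ ^ n) ⊆ stage θ n := by
  rw [stage_eq h0 h1]
  exact subset_biUnion_of_mem (u := fun k => Icc (leftEnd θ n k) (leftEnd θ n k + θ ^ n))
    (Finset.mem_coe.2 (Finset.mem_range.2 hk))

lemma gap_subset_Icc_leftEnd (h0 : 0 < θ) (n k : ℕ) :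
    gap θ n k ⊆ Icc (leftEnd θ n k) (leftEnd θ n k + θ ^ n) := by
  intro x hx
  rw [gap, center_sub_radius, center_add_radius, leftEnd_two_mul, leftEnd_two_mul_add_one] at hx
  have := pow_pos h0 n
  have := pow_pos h0 (n + 1)
  have h2 : (1 - θ) * θ ^ n = θ ^ n - θ ^ (n + 1) := by ring
  constructor <;> linarith [hx.1, hx.2]

lemma cantor_subset_stage (θ : ℝ) (n : ℕ) : cantor θ ⊆ stage θ n := iInter_subset _ n

lemma cantor_subset_Icc (θ : ℝ) : cantor θ ⊆ Icc 0 1 := cantor_subset_stage θ 0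

lemma mem_cantor_of_forall_add {x : ℝ} (n : ℕ) (h : ∀ j, x ∈ stage θ (n + j)) : x ∈ cantor θ :=
  mem_iInter.2 fun j => stage_antitone θ (Nat.le_add_left j n) (h j)

lemma leftEnd_mem_cantor (h0 : 0 < θ) (h1 : θ < 1 / 2) (hk : k < 2 ^ n) :
    leftEnd θ n k ∈ cantor θ := by
  -- The left endpoint survives as a left endpoint of all later stages.
  have key : ∀ j, ∃ i < 2 ^ (n + j), leftEnd θ (n + j) i = leftEnd θ n k := by
    intro j
    induction j with
    | zero => exact ⟨k, hk, rfl⟩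
    | succ j ih =>
      obtain ⟨i, hi, e⟩ := ih
      refine ⟨2 * i, ?_, ?_⟩
      · rw [← add_assoc, pow_succ]; omega
      · rw [← add_assoc, leftEnd_two_mul, e]
  refine mem_cantor_of_forall_add n fun j => ?_
  obtain ⟨i, hi, e⟩ := key j
  exact Icc_leftEnd_subset_stage h0 h1 hi ⟨e.le, by rw [e]; linarith [pow_pos h0 (n + j)]⟩

lemma rightEnd_mem_cantor (h0 : 0 < θ) (h1 : θ < 1 / 2) (hk : k < 2 ^ n) :
    leftEnd θ n k + θ ^ n ∈ cantor θ := by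
  have key : ∀ j, ∃ i < 2 ^ (n + j),
      leftEnd θ (n + j) i + θ ^ (n + j) = leftEnd θ n k + θ ^ n := by
    intro j
    induction j with
    | zero => exact ⟨k, hk, rfl⟩
    | succ j ih =>
      obtain ⟨i, hi, e⟩ := ih
      refine ⟨2 * i + 1, ?_, ?_⟩
      · rw [← add_assoc, pow_succ]; omega
      · rw [← add_assoc, leftEnd_two_mul_add_one, ← e]; ring
  refine mem_cantor_of_forall_add n fun j => ?_
  obtain ⟨i, hi, e⟩ := key j
  exact Icc_leftEnd_subset_stage h0 h1 hi ⟨by rw [← e]; linarith [pow_pos h0 (n + j)], e.ge⟩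

lemma center_sub_radius_mem_cantor (h0 : 0 < θ) (h1 : θ < 1 / 2) (hk : k < 2 ^ n) :
    center θ n k - radius θ n ∈ cantor θ := by
  rw [center_sub_radius]
  exact rightEnd_mem_cantor h0 h1 (by rw [pow_succ]; omega)

lemma center_add_radius_mem_cantor (h0 : 0 < θ) (h1 : θ < 1 / 2) (hk : k < 2 ^ n) :
    center θ n k + radius θ n ∈ cantor θ := by
  rw [center_add_radius]
  exact leftEnd_mem_cantor h0 h1 (by rw [pow_succ]; omega)

lemma disjoint_gap_stage_succ (hk : k < 2 ^ n) : Disjoint (gap θ n k) (stage θ (n + 1)) := by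
  rw [Set.disjoint_left]
  rintro x hx ⟨-, hx'⟩
  exact hx' (mem_biUnion (Finset.mem_coe.2 (Finset.mem_range.2 hk)) hx)

lemma disjoint_gap_cantor (hk : k < 2 ^ n) : Disjoint (gap θ n k) (cantor θ) :=
  (disjoint_gap_stage_succ hk).mono_right (cantor_subset_stage θ _)

lemma gap_subset_stage (h0 : 0 < θ) (h1 : θ < 1 / 2) (hk : k < 2 ^ n) :
    gap θ n k ⊆ stage θ n :=
  (gap_subset_Icc_leftEnd h0 n k).trans (Icc_leftEnd_subset_stage h0 h1 hk)

lemma gap_subset_Icc (h0 : 0 < θ) (h1 : θ < 1 / 2) (hk : k < 2 ^ n) : gap θ n k ⊆ Icc 0 1 :=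
  (gap_subset_stage h0 h1 hk).trans (stage_antitone θ (Nat.zero_le n))

lemma disjoint_gap_of_level_lt (h0 : 0 < θ) (h1 : θ < 1 / 2) (hnm : n < m) (hk : k < 2 ^ n)
    (hj : j < 2 ^ m) : Disjoint (gap θ n k) (gap θ m j) :=
  (disjoint_gap_stage_succ hk).mono_right
    ((gap_subset_stage h0 h1 hj).trans (stage_antitone θ hnm))

lemma disjoint_gap_of_index_lt (h0 : 0 < θ) (h1 : θ < 1 / 2) (hkj : k < j) (hj : j < 2 ^ n) :
    Disjoint (gap θ n k) (gap θ n j) := by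
  rw [Set.disjoint_left]
  intro x hx hx'
  have h2 := leftEnd_sep h0 h1 n _ _ hkj hj
  linarith [(gap_subset_Icc_leftEnd h0 n k hx).2, (gap_subset_Icc_leftEnd h0 n j hx').1]

lemma eq_of_mem_gap_of_mem_gap (h0 : 0 < θ) (h1 : θ < 1 / 2) (hk : k < 2 ^ n) (hj : j < 2 ^ m)
    {x : ℝ} (hx : x ∈ gap θ n k) (hx' : x ∈ gap θ m j) : n = m ∧ k = j := by
  rcases lt_trichotomy n m with h | rfl | h
  · exact absurd hx' (Set.disjoint_left.1 (disjoint_gap_of_level_lt h0 h1 h hk hj) hx)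
  · rcases lt_trichotomy k j with h | rfl | h
    · exact absurd hx' (Set.disjoint_left.1 (disjoint_gap_of_index_lt h0 h1 h hj) hx)
    · exact ⟨rfl, rfl⟩
    · exact absurd hx (Set.disjoint_left.1 (disjoint_gap_of_index_lt h0 h1 h hk) hx')
  · exact absurd hx (Set.disjoint_left.1 (disjoint_gap_of_level_lt h0 h1 h hj hk) hx')

lemma mem_cantor_or_mem_gap {x : ℝ} (hx : x ∈ Icc (0 : ℝ) 1) :
    x ∈ cantor θ ∨ ∃ n, ∃ k < 2 ^ n, x ∈ gap θ n k := by
  by_contra! h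
  refine h.1 (mem_iInter.2 fun n => ?_)
  induction n with
  | zero => exact hx
  | succ n ih =>
    refine ⟨ih, ?_⟩
    simp only [mem_iUnion, Finset.mem_range, not_exists]
    exact fun k hk => h.2 n k hk

lemma exists_mem_Icc_leftEnd (h0 : 0 < θ) (h1 : θ < 1 / 2) {x : ℝ} (hx : x ∈ cantor θ) (n : ℕ) :
    ∃ k < 2 ^ n, x ∈ Icc (leftEnd θ n k) (leftEnd θ n k + θ ^ n) := by
  have := cantor_subset_stage θ n hx
  rw [stage_eq h0 h1] at this
  simpa only [mem_iUnion, Finset.mem_range, exists_prop] using this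

lemma isClosed_stage (h0 : 0 < θ) (h1 : θ < 1 / 2) (n : ℕ) : IsClosed (stage θ n) := by
  rw [stage_eq h0 h1]
  exact isClosed_biUnion_finset fun _ _ => isClosed_Icc

lemma isClosed_cantor (h0 : 0 < θ) (h1 : θ < 1 / 2) : IsClosed (cantor θ) :=
  isClosed_iInter (isClosed_stage h0 h1)

lemma volume_cantor (h0 : 0 < θ) (h1 : θ < 1 / 2) : volume (cantor θ) = 0 := by
  have hle : ∀ n : ℕ, volume (cantor θ) ≤ ENNReal.ofReal ((2 * θ) ^ n) := by
    intro n
    calc volume (cantor θ) ≤ volume (stage θ n) := measure_mono (cantor_subset_stage θ n)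
      _ ≤ ∑ k ∈ Finset.range (2 ^ n),
            volume (Icc (leftEnd θ n k) (leftEnd θ n k + θ ^ n)) := by
          rw [stage_eq h0 h1]; exact measure_biUnion_finset_le _ _
      _ = ENNReal.ofReal ((2 * θ) ^ n) := by
          simp only [Real.volume_Icc, add_sub_cancel_left, Finset.sum_const, Finset.card_range,
            nsmul_eq_mul]
          rw [mul_pow, ENNReal.ofReal_mul (by positivity)]
          simp
  have hlim : Filter.Tendsto (fun n : ℕ => ENNReal.ofReal ((2 * θ) ^ n)) Filter.atTop (nhds 0) := by
    rw [← ENNReal.ofReal_zero]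
    exact ENNReal.tendsto_ofReal
      (tendsto_pow_atTop_nhds_zero_of_lt_one (by linarith) (by linarith))
  exact le_antisymm (ge_of_tendsto' hlim hle) zero_le

lemma zero_mem_cantor (h0 : 0 < θ) (h1 : θ < 1 / 2) : (0 : ℝ) ∈ cantor θ := by
  simpa [leftEnd] using leftEnd_mem_cantor (n := 0) (k := 0) h0 h1 (by norm_num)

lemma one_mem_cantor (h0 : 0 < θ) (h1 : θ < 1 / 2) : (1 : ℝ) ∈ cantor θ := by
  simpa [leftEnd] using rightEnd_mem_cantor (n := 0) (k := 0) h0 h1 (by norm_num)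

lemma compl_cantor (θ : ℝ) :
    (cantor θ)ᶜ = Iio 0 ∪ (⋃ n, ⋃ k ∈ Finset.range (2 ^ n), gap θ n k) ∪ Ioi 1 := by
  ext x
  simp only [mem_compl_iff, mem_union, mem_Iio, mem_Ioi, mem_iUnion, Finset.mem_range, exists_prop]
  constructor
  · intro hx
    by_cases h : x ∈ Icc (0 : ℝ) 1
    · exact Or.inl (Or.inr ((mem_cantor_or_mem_gap h).resolve_left hx))
    · rw [mem_Icc, not_and_or, not_le, not_le] at h
      exact h.elim (fun h => Or.inl (Or.inl h)) Or.inr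
  · rintro ((h | ⟨n, k, hk, h⟩) | h) hx
    · exact absurd (cantor_subset_Icc θ hx).1 (not_le.2 h)
    · exact Set.disjoint_left.1 (disjoint_gap_cantor hk) h hx
    · exact absurd (cantor_subset_Icc θ hx).2 (not_le.2 h)

/-! ### Integration over the gaps -/

/-- Countable additivity over sets `S n k` chosen inside the (disjoint) gaps. -/
lemma restrict_iUnion_of_subset_gap (h0 : 0 < θ) (h1 : θ < 1 / 2) {S : ℕ → ℕ → Set ℝ}
    (hS : ∀ n k, MeasurableSet (S n k)) (hsub : ∀ n k, S n k ⊆ gap θ n k) :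
    volume.restrict (⋃ n, ⋃ k ∈ Finset.range (2 ^ n), S n k) =
      Measure.sum fun n => ∑ k ∈ Finset.range (2 ^ n), volume.restrict (S n k) := by
  have hdisj : ∀ n m k j, k < 2 ^ n → j < 2 ^ m → (n, k) ≠ (m, j) →
      Disjoint (S n k) (S m j) := by
    intro n m k j hk hj hne
    rw [Set.disjoint_left]
    intro x hx hx'
    obtain ⟨rfl, rfl⟩ := eq_of_mem_gap_of_mem_gap h0 h1 hk hj (hsub _ _ hx) (hsub _ _ hx')
    exact hne rfl
  rw [Measure.restrict_iUnion]
  · congr 1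
    funext n
    rw [Measure.restrict_biUnion_finset]
    · rw [Measure.sum_coe_finset (Finset.range (2 ^ n)) fun k => volume.restrict (S n k)]
    · intro k hk j hj hkj
      exact hdisj n n k j (Finset.mem_range.1 hk) (Finset.mem_range.1 hj) (by simpa using hkj)
    · exact fun k => hS n k
  · intro n m hnm
    simp only [Function.onFun, disjoint_iUnion_left, disjoint_iUnion_right, Finset.mem_range]
    exact fun k hk j hj => hdisj n m _ _ (by assumption) (by assumption) (by simp [hnm])
  · exact fun n => Finset.measurableSet_biUnion _ fun k _ => hS n k

/-! ### The map `F_1` on the Cantor set and on the gaps -/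

/-- The shrunk copy of a gap that contributes to `Ω(θ)`. -/
def core (θ : ℝ) (n k : ℕ) : Set ℝ :=
  Ioo (center θ n k - θ * radius θ n) (center θ n k + θ * radius θ n)

lemma omegaSet_eq_iUnion_core (θ : ℝ) :
    omegaSet θ = ⋃ n, ⋃ k ∈ Finset.range (2 ^ n), core θ n k := rfl

lemma core_subset_gap (h0 : 0 < θ) (h1 : θ < 1 / 2) (n k : ℕ) : core θ n k ⊆ gap θ n k := by
  have := theta_mul_radius_lt h0 h1 n
  exact Ioo_subset_Ioo (by linarith) (by linarith)

lemma core_subset_omegaSet (hk : k < 2 ^ n) : core θ n k ⊆ omegaSet θ :=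
  fun _ hx => mem_iUnion_of_mem n (mem_biUnion (Finset.mem_coe.2 (Finset.mem_range.2 hk)) hx)

lemma mem_omegaSet {x : ℝ} : x ∈ omegaSet θ ↔ ∃ n, ∃ k < 2 ^ n, x ∈ core θ n k := by
  simp only [omegaSet_eq_iUnion_core, mem_iUnion, Finset.mem_range, exists_prop]

lemma isOpen_omegaSet (θ : ℝ) : IsOpen (omegaSet θ) :=
  isOpen_iUnion fun _ => isOpen_biUnion fun _ _ => isOpen_Ioo

lemma omegaSet_subset_Icc (h0 : 0 < θ) (h1 : θ < 1 / 2) : omegaSet θ ⊆ Icc 0 1 := by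
  intro x hx
  obtain ⟨n, k, hk, hx⟩ := mem_omegaSet.1 hx
  exact gap_subset_Icc h0 h1 hk (core_subset_gap h0 h1 n k hx)

lemma disjoint_cantor_omegaSet (h0 : 0 < θ) (h1 : θ < 1 / 2) :
    Disjoint (cantor θ) (omegaSet θ) := by
  rw [Set.disjoint_right]
  intro x hx
  obtain ⟨n, k, hk, hx⟩ := mem_omegaSet.1 hx
  exact Set.disjoint_left.1 (disjoint_gap_cantor hk) (core_subset_gap h0 h1 n k hx)

lemma mem_core_of_mem_gap_of_mem_omegaSet (h0 : 0 < θ) (h1 : θ < 1 / 2) (hk : k < 2 ^ n) {x : ℝ}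
    (hx : x ∈ gap θ n k) (hx' : x ∈ omegaSet θ) : x ∈ core θ n k := by
  obtain ⟨m, j, hj, hxj⟩ := mem_omegaSet.1 hx'
  obtain ⟨rfl, rfl⟩ := eq_of_mem_gap_of_mem_gap h0 h1 hk hj hx (core_subset_gap h0 h1 m j hxj)
  exact hxj

/-- The gaps fill `[0, 1]` up to the null set `K(θ)`. -/
lemma restrict_Icc_eq_sum_gap (h0 : 0 < θ) (h1 : θ < 1 / 2) :
    (volume : Measure ℝ).restrict (Icc 0 1) =
      Measure.sum fun n => ∑ k ∈ Finset.range (2 ^ n), volume.restrict (gap θ n k) := by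
  rw [← restrict_iUnion_of_subset_gap h0 h1 (S := gap θ)
    (fun _ _ => measurableSet_Ioo) fun _ _ => Subset.rfl]
  refine Measure.restrict_congr_set ?_
  have hK : ∀ᵐ x : ℝ, x ∉ cantor θ := measure_eq_zero_iff_ae_notMem.1 (volume_cantor h0 h1)
  filter_upwards [hK] with x hx
  refine propext ⟨fun h => ?_, fun h => ?_⟩
  · obtain ⟨n, k, hk, hxk⟩ := (mem_cantor_or_mem_gap h).resolve_left hx
    exact mem_iUnion_of_mem n (mem_biUnion (Finset.mem_coe.2 (Finset.mem_range.2 hk)) hxk)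
  · obtain ⟨n, h⟩ := mem_iUnion.1 h
    obtain ⟨k, hk, h⟩ := mem_iUnion₂.1 h
    exact gap_subset_Icc h0 h1 (Finset.mem_range.1 hk) h

/-- To the left of a point of `K(θ)` the set `Ω(θ)` has relative density exactly `θ`: such a point
never cuts a gap, and `Ω(θ)` takes the proportion `θ` of every gap. -/
lemma volume_omegaSet_inter_Ioo (h0 : 0 < θ) (h1 : θ < 1 / 2) {x : ℝ} (hx : x ∈ cantor θ) :
    volume (omegaSet θ ∩ Ioo 0 x) = ENNReal.ofReal θ * ENNReal.ofReal x := by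
  have hI : MeasurableSet (Ioo 0 x) := measurableSet_Ioo
  have e1 : volume (omegaSet θ ∩ Ioo 0 x) =
      ∑' n, ∑ k ∈ Finset.range (2 ^ n), volume (Ioo 0 x ∩ core θ n k) := by
    rw [inter_comm, ← Measure.restrict_apply hI, omegaSet_eq_iUnion_core,
      restrict_iUnion_of_subset_gap h0 h1 (S := core θ) (fun _ _ => measurableSet_Ioo)
        (core_subset_gap h0 h1), Measure.sum_apply _ hI]
    simp [Measure.restrict_apply hI]
  have e2 : ENNReal.ofReal x =
      ∑' n, ∑ k ∈ Finset.range (2 ^ n), volume (Ioo 0 x ∩ gap θ n k) := by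
    have : ENNReal.ofReal x = (volume.restrict (Icc (0 : ℝ) 1)) (Ioo 0 x) := by
      rw [Measure.restrict_apply hI, inter_eq_left.2, Real.volume_Ioo, sub_zero]
      exact Ioo_subset_Icc_self.trans (Icc_subset_Icc_right (cantor_subset_Icc θ hx).2)
    rw [this, restrict_Icc_eq_sum_gap h0 h1, Measure.sum_apply _ hI]
    simp [Measure.restrict_apply hI]
  rw [e1, e2, ← ENNReal.tsum_mul_left]
  refine tsum_congr fun n => ?_
  rw [Finset.mul_sum]
  refine Finset.sum_congr rfl fun k hk => ?_
  have hk := Finset.mem_range.1 hk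
  have hxg : x ∉ gap θ n k := fun h => Set.disjoint_left.1 (disjoint_gap_cantor hk) h hx
  have hc := core_subset_gap h0 h1 n k
  rw [gap, mem_Ioo, not_and_or, not_lt, not_lt] at hxg
  -- The gap lies entirely to the right or entirely to the left of `x`.
  rcases hxg with hle | hge
  · have : Ioo 0 x ∩ gap θ n k = ∅ := by
      rw [← disjoint_iff_inter_eq_empty, Set.disjoint_left]
      exact fun y hy hy' => by linarith [hy.2, hy'.1]
    rw [this, subset_eq_empty (inter_subset_inter_right _ hc) this]
    simp
  · have hsub : gap θ n k ⊆ Ioo 0 x := by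
      intro y hy
      exact ⟨lt_of_le_of_lt (cantor_subset_Icc θ (center_sub_radius_mem_cantor h0 h1 hk)).1 hy.1,
        lt_of_lt_of_le hy.2 hge⟩
    rw [inter_eq_right.2 hsub, inter_eq_right.2 (hc.trans hsub), core, gap, Real.volume_Ioo,
      Real.volume_Ioo, ← ENNReal.ofReal_mul h0.le]
    congr 1
    ring

lemma F_apply (θ t y : ℝ) : F θ t y = y + t * profile θ y := rfl

lemma F_one_of_mem_Icc {y : ℝ} (hy : y ∈ Icc (0 : ℝ) 1) :
    F θ 1 y = (1 / θ) * volume.real (omegaSet θ ∩ Ioo 0 y) := by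
  rw [F_apply, profile, if_pos hy]; ring

lemma profile_of_notMem_Icc {y : ℝ} (hy : y ∉ Icc (0 : ℝ) 1) : profile θ y = 0 := by
  rw [profile, if_neg hy]

lemma F_one_of_mem_cantor (h0 : 0 < θ) (h1 : θ < 1 / 2) {x : ℝ} (hx : x ∈ cantor θ) :
    F θ 1 x = x := by
  rw [F_one_of_mem_Icc (cantor_subset_Icc θ hx), Measure.real, volume_omegaSet_inter_Ioo h0 h1 hx,
    ← ENNReal.ofReal_mul h0.le,
    ENNReal.toReal_ofReal (mul_nonneg h0.le (cantor_subset_Icc θ hx).1)]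
  field_simp

lemma F_one_of_notMem_Icc {y : ℝ} (hy : y ∉ Icc (0 : ℝ) 1) : F θ 1 y = y := by
  rw [F_apply, profile_of_notMem_Icc hy]; ring

lemma profile_of_mem_cantor (h0 : 0 < θ) (h1 : θ < 1 / 2) {x : ℝ} (hx : x ∈ cantor θ) :
    profile θ x = 0 := by
  have := F_one_of_mem_cantor h0 h1 hx
  rw [F_apply] at this
  linarith

lemma F_one_sub {x y : ℝ} (hx : x ∈ Icc (0 : ℝ) 1) (hy : y ∈ Icc (0 : ℝ) 1)
    (hxy : x ≤ y) : F θ 1 y - F θ 1 x = (1 / θ) * volume.real (omegaSet θ ∩ Ico x y) := by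
  rcases hx.1.eq_or_lt with rfl | hx0
  · rw [F_one_of_mem_Icc hx, F_one_of_mem_Icc hy]
    have : (omegaSet θ ∩ Ioo 0 y : Set ℝ) =ᵐ[volume] (omegaSet θ ∩ Ico 0 y : Set ℝ) :=
      (Filter.EventuallyEq.refl _ _).inter Ioo_ae_eq_Ico
    rw [measureReal_congr this]
    simp
  have hU : omegaSet θ ∩ Ioo 0 y = (omegaSet θ ∩ Ioo 0 x) ∪ (omegaSet θ ∩ Ico x y) := by
    rw [← inter_union_distrib_left, Ioo_union_Ico_eq_Ioo hx0 hxy]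
  have hfin : ∀ a b : ℝ, volume (omegaSet θ ∩ Ioo a b) ≠ ⊤ := fun a b =>
    measure_ne_top_of_subset inter_subset_right (by simp)
  have hfin' : ∀ a b : ℝ, volume (omegaSet θ ∩ Ico a b) ≠ ⊤ := fun a b =>
    measure_ne_top_of_subset inter_subset_right (by simp)
  rw [F_one_of_mem_Icc hx, F_one_of_mem_Icc hy, hU, measureReal_union _ _ (hfin _ _) (hfin' _ _)]
  · ring
  · rw [Set.disjoint_left]
    exact fun z hz hz' => by linarith [hz.2.2, hz'.2.1]
  · exact (isOpen_omegaSet θ).measurableSet.inter measurableSet_Ico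

lemma F_one_sub_mem_Icc (h0 : 0 < θ) {x y : ℝ} (hx : x ∈ Icc (0 : ℝ) 1) (hy : y ∈ Icc (0 : ℝ) 1)
    (hxy : x ≤ y) : F θ 1 y - F θ 1 x ∈ Icc 0 ((1 / θ) * (y - x)) := by
  rw [F_one_sub hx hy hxy]
  refine ⟨by positivity, mul_le_mul_of_nonneg_left ?_ (by positivity)⟩
  calc volume.real (omegaSet θ ∩ Ico x y) ≤ volume.real (Ico x y) :=
        measureReal_mono inter_subset_right (by simp)
    _ = y - x := by rw [Real.volume_real_Ico_of_le hxy]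

lemma F_one_zero (h0 : 0 < θ) (h1 : θ < 1 / 2) : F θ 1 0 = 0 :=
  F_one_of_mem_cantor h0 h1 (zero_mem_cantor h0 h1)

lemma F_one_one (h0 : 0 < θ) (h1 : θ < 1 / 2) : F θ 1 1 = 1 :=
  F_one_of_mem_cantor h0 h1 (one_mem_cantor h0 h1)

lemma F_one_sub_mem_Icc_of_le (h0 : 0 < θ) (h1 : θ < 1 / 2) {x y : ℝ} (hxy : x ≤ y) :
    F θ 1 y - F θ 1 x ∈ Icc 0 ((1 / θ) * (y - x)) := by
  have hθ : 1 ≤ 1 / θ := by rw [le_div_iff₀ h0]; linarith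
  have hθ' : ∀ z : ℝ, 0 ≤ z → z ≤ (1 / θ) * z := fun z hz => le_mul_of_one_le_left hz hθ
  have z0 := F_one_zero h0 h1
  have z1 := F_one_one h0 h1
  have m0 : (0 : ℝ) ∈ Icc (0 : ℝ) 1 := by simp
  have m1 : (1 : ℝ) ∈ Icc (0 : ℝ) 1 := by simp
  by_cases hx : x ∈ Icc (0 : ℝ) 1 <;> by_cases hy : y ∈ Icc (0 : ℝ) 1
  · exact F_one_sub_mem_Icc h0 hx hy hxy
  · have hy1 : 1 < y := by by_contra! h; exact hy ⟨hx.1.trans hxy, h⟩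
    have a := F_one_sub_mem_Icc h0 hx m1 hx.2
    have b := hθ' (y - 1) (by linarith)
    rw [F_one_of_notMem_Icc hy]
    rw [z1] at a
    constructor <;> nlinarith [a.1, a.2]
  · have hx0 : x < 0 := by by_contra! h; exact hx ⟨h, hxy.trans hy.2⟩
    have a := F_one_sub_mem_Icc h0 m0 hy hy.1
    have b := hθ' (0 - x) (by linarith)
    rw [F_one_of_notMem_Icc hx]
    rw [z0] at a
    constructor <;> nlinarith [a.1, a.2]
  · rw [F_one_of_notMem_Icc hx, F_one_of_notMem_Icc hy]
    exact ⟨by linarith, hθ' _ (by linarith)⟩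

lemma monotone_F_one (h0 : 0 < θ) (h1 : θ < 1 / 2) : Monotone (F θ 1) := fun _ _ hxy =>
  sub_nonneg.1 (F_one_sub_mem_Icc_of_le h0 h1 hxy).1

lemma exists_lipschitzWith_profile (h0 : 0 < θ) (h1 : θ < 1 / 2) :
    ∃ L : ℝ≥0, LipschitzWith L (profile θ) := by
  refine ⟨Real.toNNReal (1 / θ), LipschitzWith.of_le_add_mul' _ fun x y => ?_⟩
  have hθ : 1 ≤ 1 / θ := by rw [le_div_iff₀ h0]; linarith
  have e : ∀ z, profile θ z = F θ 1 z - z := fun z => by rw [F_apply]; ring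
  rw [e, e, Real.dist_eq]
  rcases le_total x y with h | h
  · have a := (F_one_sub_mem_Icc_of_le h0 h1 h).1
    rw [abs_sub_comm, abs_of_nonneg (sub_nonneg.2 h)]
    nlinarith
  · have a := (F_one_sub_mem_Icc_of_le h0 h1 h).2
    rw [abs_of_nonneg (sub_nonneg.2 h)]
    linarith

lemma continuous_profile (h0 : 0 < θ) (h1 : θ < 1 / 2) : Continuous (profile θ) :=
  let ⟨_, hL⟩ := exists_lipschitzWith_profile h0 h1
  hL.continuous

lemma continuous_F_one (h0 : 0 < θ) (h1 : θ < 1 / 2) : Continuous (F θ 1) := by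
  have : F θ 1 = fun y => y + 1 * profile θ y := rfl
  rw [this]
  have := continuous_profile h0 h1
  fun_prop

/-! On the closure of a gap, `F_1` is constant on both sides of the core and maps the core affinely
onto the gap. -/

lemma mem_Icc_of_mem_closed_gap (h0 : 0 < θ) (h1 : θ < 1 / 2) (hk : k < 2 ^ n) {y : ℝ}
    (hy : y ∈ Icc (center θ n k - radius θ n) (center θ n k + radius θ n)) :
    y ∈ Icc (0 : ℝ) 1 :=
  ⟨(cantor_subset_Icc θ (center_sub_radius_mem_cantor h0 h1 hk)).1.trans hy.1,
    hy.2.trans (cantor_subset_Icc θ (center_add_radius_mem_cantor h0 h1 hk)).2⟩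

lemma F_one_core_right (h0 : 0 < θ) (h1 : θ < 1 / 2) (hk : k < 2 ^ n) {y : ℝ}
    (hy : y ∈ Icc (center θ n k + θ * radius θ n) (center θ n k + radius θ n)) :
    F θ 1 y = center θ n k + radius θ n := by
  have hr := radius_pos h0 h1 n
  have hθr : 0 < θ * radius θ n := mul_pos h0 hr
  have hK := center_add_radius_mem_cantor h0 h1 hk
  have a := F_one_sub (θ := θ)
    (mem_Icc_of_mem_closed_gap h0 h1 hk ⟨by linarith [hy.1], hy.2⟩) (cantor_subset_Icc θ hK) hy.2
  have hempty : omegaSet θ ∩ Ico y (center θ n k + radius θ n) = ∅ := by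
    rw [← disjoint_iff_inter_eq_empty, Set.disjoint_left]
    intro z hz hz'
    have := mem_core_of_mem_gap_of_mem_omegaSet h0 h1 hk
      ⟨by linarith [hz'.1, hy.1], hz'.2⟩ hz
    linarith [this.2, hz'.1, hy.1]
  rw [hempty, F_one_of_mem_cantor h0 h1 hK] at a
  simp at a
  linarith

lemma F_one_core (h0 : 0 < θ) (h1 : θ < 1 / 2) (hk : k < 2 ^ n) {y : ℝ}
    (hy : y ∈ Icc (center θ n k - θ * radius θ n) (center θ n k + θ * radius θ n)) :
    F θ 1 y = center θ n k + (y - center θ n k) / θ := by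
  have hr := radius_pos h0 h1 n
  have hlt := theta_mul_radius_lt h0 h1 n
  have a := F_one_sub (θ := θ)
    (mem_Icc_of_mem_closed_gap h0 h1 hk ⟨by linarith [hy.1], by linarith [hy.2]⟩)
    (mem_Icc_of_mem_closed_gap (y := center θ n k + θ * radius θ n) h0 h1 hk
      ⟨by linarith [hy.1, hy.2], by linarith [hy.2]⟩) hy.2
  have hae : (Ico y (center θ n k + θ * radius θ n) : Set ℝ) =ᵐ[volume]
      (omegaSet θ ∩ Ico y (center θ n k + θ * radius θ n) : Set ℝ) := by
    refine (Ioo_ae_eq_Ico).symm.trans (Filter.EventuallyEq.trans ?_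
      ((Filter.EventuallyEq.refl _ (omegaSet θ)).inter Ioo_ae_eq_Ico))
    have hsub : Ioo y (center θ n k + θ * radius θ n) ⊆ omegaSet θ := fun z hz =>
      core_subset_omegaSet hk ⟨lt_of_le_of_lt hy.1 hz.1, hz.2⟩
    rw [inter_eq_right.2 hsub]
    exact Filter.EventuallyEq.refl _ _
  rw [← measureReal_congr hae, Real.volume_real_Ico_of_le hy.2,
    F_one_core_right h0 h1 hk ⟨le_rfl, by linarith⟩] at a
  field_simp at a ⊢
  linarith

lemma F_one_core_left (h0 : 0 < θ) (h1 : θ < 1 / 2) (hk : k < 2 ^ n) {y : ℝ}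
    (hy : y ∈ Icc (center θ n k - radius θ n) (center θ n k - θ * radius θ n)) :
    F θ 1 y = center θ n k - radius θ n := by
  have hr := radius_pos h0 h1 n
  have hθr : 0 < θ * radius θ n := mul_pos h0 hr
  refine le_antisymm ?_ ?_
  · refine (monotone_F_one h0 h1 hy.2).trans (le_of_eq ?_)
    rw [F_one_core h0 h1 hk ⟨le_rfl, by linarith⟩]
    field_simp
    ring
  · have := monotone_F_one h0 h1 hy.1
    rwa [F_one_of_mem_cantor h0 h1 (center_sub_radius_mem_cantor h0 h1 hk)] at this

/-! ### Monotonicity and images -/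

lemma isHamiltonianFlow_freeFlow : IsHamiltonianFlow freeHamiltonian freeFlow := by
  intro z
  refine ⟨by simp [freeFlow], fun t => ?_⟩
  have e1 : deriv (fun ξ : ℝ => freeHamiltonian (freeFlow t z).1 ξ) (freeFlow t z).2 = z.2 := by
    have : HasDerivAt (fun ξ : ℝ => ξ ^ 2 / 2) z.2 z.2 := by
      have := (hasDerivAt_pow 2 z.2).div_const 2
      simpa using this
    exact this.deriv
  have e2 : deriv (fun x : ℝ => freeHamiltonian x (freeFlow t z).2) (freeFlow t z).1 = 0 := by
    simp [freeHamiltonian]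
  rw [e1, e2, neg_zero]
  have h1 : HasDerivAt (fun τ : ℝ => z.1 + τ * z.2) z.2 t := by
    simpa using ((hasDerivAt_id t).mul_const z.2).const_add z.1
  exact h1.prodMk (hasDerivAt_const t z.2)

lemma tsupport_profile_subset (θ : ℝ) : tsupport (profile θ) ⊆ Icc 0 1 := by
  refine closure_minimal (fun y hy => ?_) isClosed_Icc
  by_contra h
  exact hy (profile_of_notMem_Icc h)

/-- Strict monotonicity only needs, besides monotonicity, that `F_1` grows immediately to the right
of every point of the set. -/
lemma exists_F_one_lt (h0 : 0 < θ) (h1 : θ < 1 / 2) {x y : ℝ} (hxy : x < y)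
    (hx : x ∈ Iio 0 ∪ omegaSet θ ∪ Ioi 1) : ∃ z ∈ Ioo x y, F θ 1 x < F θ 1 z := by
  rcases hx with (hx | hx) | hx
  · obtain ⟨z, hz, hz'⟩ := exists_between (lt_min hxy hx)
    have hz' := lt_min_iff.1 hz'
    refine ⟨z, ⟨hz, hz'.1⟩, ?_⟩
    rwa [F_one_of_notMem_Icc (fun h => absurd h.1 (not_le.2 hx)),
      F_one_of_notMem_Icc (fun h => absurd h.1 (not_le.2 hz'.2))]
  · obtain ⟨n, k, hk, hx⟩ := mem_omegaSet.1 hx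
    obtain ⟨z, hz, hz'⟩ := exists_between (lt_min hxy hx.2)
    have hz' := lt_min_iff.1 hz'
    refine ⟨z, ⟨hz, hz'.1⟩, ?_⟩
    rw [F_one_core h0 h1 hk (Ioo_subset_Icc_self hx),
      F_one_core h0 h1 hk ⟨(hx.1.trans hz).le, hz'.2.le⟩]
    gcongr
  · obtain ⟨z, hz, hz'⟩ := exists_between hxy
    have hx : 1 < x := hx
    refine ⟨z, ⟨hz, hz'⟩, ?_⟩
    rwa [F_one_of_notMem_Icc (fun h => absurd h.2 (not_le.2 hx)),
      F_one_of_notMem_Icc (fun h => absurd h.2 (not_le.2 (hx.trans hz)))]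

lemma strictMonoOn_F_one (h0 : 0 < θ) (h1 : θ < 1 / 2) :
    StrictMonoOn (F θ 1) (Iio 0 ∪ omegaSet θ ∪ Ioi 1) := by
  intro x hx y _ hxy
  obtain ⟨z, hz, hlt⟩ := exists_F_one_lt h0 h1 hxy hx
  exact hlt.trans_le (monotone_F_one h0 h1 hz.2.le)

lemma image_F_one_core (h0 : 0 < θ) (h1 : θ < 1 / 2) (hk : k < 2 ^ n) :
    F θ 1 '' core θ n k = gap θ n k := by
  ext x
  constructor
  · rintro ⟨y, hy, rfl⟩
    rw [F_one_core h0 h1 hk (Ioo_subset_Icc_self hy)]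
    have a : -radius θ n < (y - center θ n k) / θ := by
      rw [lt_div_iff₀ h0]; linarith [hy.1]
    have b : (y - center θ n k) / θ < radius θ n := by
      rw [div_lt_iff₀ h0]; linarith [hy.2]
    exact ⟨by linarith, by linarith⟩
  · intro hx
    have hy : center θ n k + θ * (x - center θ n k) ∈ core θ n k :=
      ⟨by nlinarith [hx.1], by nlinarith [hx.2]⟩
    refine ⟨_, hy, ?_⟩
    rw [F_one_core h0 h1 hk (Ioo_subset_Icc_self hy)]
    field_simp
    ring

lemma image_F_one_eq_compl_cantor (h0 : 0 < θ) (h1 : θ < 1 / 2) :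
    F θ 1 '' (Iio 0 ∪ omegaSet θ ∪ Ioi 1) = (cantor θ)ᶜ := by
  have e1 : F θ 1 '' Iio 0 = Iio 0 := by
    rw [image_congr (g := id), image_id]
    exact fun y hy => F_one_of_notMem_Icc fun h => absurd h.1 (not_le.2 hy)
  have e2 : F θ 1 '' Ioi 1 = Ioi 1 := by
    rw [image_congr (g := id), image_id]
    exact fun y hy => F_one_of_notMem_Icc fun h => absurd h.2 (not_le.2 hy)
  have e3 : F θ 1 '' omegaSet θ = ⋃ n, ⋃ k ∈ Finset.range (2 ^ n), gap θ n k := by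
    rw [omegaSet_eq_iUnion_core, image_iUnion]
    refine iUnion_congr fun n => ?_
    rw [image_iUnion₂]
    exact iUnion₂_congr fun k hk => image_F_one_core h0 h1 (Finset.mem_range.1 hk)
  rw [image_union, image_union, e1, e2, e3, compl_cantor]

lemma cantor_subset_cantorTilde (h0 : 0 < θ) (h1 : θ < 1 / 2) : cantor θ ⊆ cantorTilde θ :=
  subset_sdiff.2 ⟨cantor_subset_Icc θ, disjoint_cantor_omegaSet h0 h1⟩

/-- The part of `K̃(θ)` inside the closure of a gap, to the left of its core. -/
def leftPart (θ : ℝ) (n k : ℕ) : Set ℝ :=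
  Ioc (center θ n k - radius θ n) (center θ n k - θ * radius θ n)

/-- The part of `K̃(θ)` inside the closure of a gap, to the right of its core. -/
def rightPart (θ : ℝ) (n k : ℕ) : Set ℝ :=
  Ico (center θ n k + θ * radius θ n) (center θ n k + radius θ n)

lemma leftPart_union_rightPart_subset_gap (h0 : 0 < θ) (h1 : θ < 1 / 2) (n k : ℕ) :
    leftPart θ n k ∪ rightPart θ n k ⊆ gap θ n k := by
  have hr := radius_pos h0 h1 n
  have hθr : 0 < θ * radius θ n := mul_pos h0 hr
  rintro x (hx | hx)
  · exact ⟨hx.1, by linarith [hx.2]⟩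
  · exact ⟨by linarith [hx.1], hx.2⟩

lemma mem_leftPart_or_mem_rightPart {x : ℝ} (hx : x ∈ gap θ n k) (hx' : x ∉ core θ n k) :
    x ∈ leftPart θ n k ∪ rightPart θ n k := by
  rw [core, mem_Ioo, not_and_or, not_lt, not_lt] at hx'
  exact hx'.imp (fun h => ⟨hx.1, h⟩) fun h => ⟨h, hx.2⟩

lemma disjoint_leftPart_union_rightPart_core (n k : ℕ) :
    Disjoint (leftPart θ n k ∪ rightPart θ n k) (core θ n k) := by
  rw [Set.disjoint_left]
  rintro x (hx | hx) hx'
  · exact absurd hx'.1 (not_lt.2 hx.2)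
  · exact absurd hx'.2 (not_lt.2 hx.1)

lemma cantorTilde_eq (h0 : 0 < θ) (h1 : θ < 1 / 2) : cantorTilde θ =
    cantor θ ∪ ⋃ n, ⋃ k ∈ Finset.range (2 ^ n), (leftPart θ n k ∪ rightPart θ n k) := by
  ext x
  constructor
  · rintro ⟨hx, hxo⟩
    refine (mem_cantor_or_mem_gap hx).imp_right ?_
    rintro ⟨n, k, hk, hg⟩
    exact mem_iUnion_of_mem n (mem_biUnion (Finset.mem_coe.2 (Finset.mem_range.2 hk))
      (mem_leftPart_or_mem_rightPart hg fun h => hxo (core_subset_omegaSet hk h)))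
  · rintro (hx | hx)
    · exact cantor_subset_cantorTilde h0 h1 hx
    · obtain ⟨n, hx⟩ := mem_iUnion.1 hx
      obtain ⟨k, hk, hx⟩ := mem_iUnion₂.1 hx
      have hk := Finset.mem_range.1 hk
      have hg := leftPart_union_rightPart_subset_gap h0 h1 n k hx
      exact ⟨gap_subset_Icc h0 h1 hk hg, fun ho =>
        Set.disjoint_left.1 (disjoint_leftPart_union_rightPart_core n k)
          hx (mem_core_of_mem_gap_of_mem_omegaSet h0 h1 hk hg ho)⟩

lemma F_one_of_mem_leftPart (h0 : 0 < θ) (h1 : θ < 1 / 2) (hk : k < 2 ^ n) {y : ℝ}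
    (hy : y ∈ leftPart θ n k) : F θ 1 y = center θ n k - radius θ n :=
  F_one_core_left h0 h1 hk (Ioc_subset_Icc_self hy)

lemma F_one_of_mem_rightPart (h0 : 0 < θ) (h1 : θ < 1 / 2) (hk : k < 2 ^ n) {y : ℝ}
    (hy : y ∈ rightPart θ n k) : F θ 1 y = center θ n k + radius θ n :=
  F_one_core_right h0 h1 hk (Ico_subset_Icc_self hy)

lemma image_F_one_cantorTilde (h0 : 0 < θ) (h1 : θ < 1 / 2) :
    F θ 1 '' cantorTilde θ = cantor θ := by
  refine Subset.antisymm ?_ fun x hx =>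
    ⟨x, cantor_subset_cantorTilde h0 h1 hx, F_one_of_mem_cantor h0 h1 hx⟩
  rintro _ ⟨y, hy, rfl⟩
  rw [cantorTilde_eq h0 h1] at hy
  rcases hy with hy | hy
  · rwa [F_one_of_mem_cantor h0 h1 hy]
  · obtain ⟨n, hy⟩ := mem_iUnion.1 hy
    obtain ⟨k, hk, hy⟩ := mem_iUnion₂.1 hy
    have hk := Finset.mem_range.1 hk
    rcases hy with hy | hy
    · rw [F_one_of_mem_leftPart h0 h1 hk hy]
      exact center_sub_radius_mem_cantor h0 h1 hk
    · rw [F_one_of_mem_rightPart h0 h1 hk hy]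
      exact center_add_radius_mem_cantor h0 h1 hk

/-! ### The transported measure and its marginal -/

lemma measurableSet_cantorTilde (θ : ℝ) : MeasurableSet (cantorTilde θ) :=
  measurableSet_Icc.diff (isOpen_omegaSet θ).measurableSet

lemma withDensity_density (θ : ℝ) :
    (volume.withDensity fun x => ENNReal.ofReal (density θ x)) =
      ENNReal.ofReal (1 / (1 - θ)) • volume.restrict (cantorTilde θ) := by
  have : (fun x => ENNReal.ofReal (density θ x)) =
      (cantorTilde θ).indicator fun _ => ENNReal.ofReal (1 / (1 - θ)) := by
    funext x
    by_cases hx : x ∈ cantorTilde θ <;> simp [density, hx]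
  rw [this, withDensity_indicator (measurableSet_cantorTilde θ), withDensity_const]

lemma restrict_cantorTilde (h0 : 0 < θ) (h1 : θ < 1 / 2) :
    (volume : Measure ℝ).restrict (cantorTilde θ) =
      Measure.sum fun n => ∑ k ∈ Finset.range (2 ^ n),
        (volume.restrict (leftPart θ n k) + volume.restrict (rightPart θ n k)) := by
  have hdisj : ∀ n k, Disjoint (leftPart θ n k) (rightPart θ n k) := by
    intro n k
    have := mul_pos h0 (radius_pos h0 h1 n)
    rw [Set.disjoint_left]
    exact fun x hx hx' => by linarith [hx.2, hx'.1]
  have hnull : (cantor θ ∪ ⋃ n, ⋃ k ∈ Finset.range (2 ^ n),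
      (leftPart θ n k ∪ rightPart θ n k) : Set ℝ) =ᵐ[volume]
      (⋃ n, ⋃ k ∈ Finset.range (2 ^ n), (leftPart θ n k ∪ rightPart θ n k) : Set ℝ) :=
    union_ae_eq_right_of_ae_eq_empty (ae_eq_empty.2 (volume_cantor h0 h1))
  rw [cantorTilde_eq h0 h1, Measure.restrict_congr_set hnull,
    restrict_iUnion_of_subset_gap h0 h1 (S := fun n k => leftPart θ n k ∪ rightPart θ n k)
      (fun _ _ => measurableSet_Ioc.union measurableSet_Ico)
      (leftPart_union_rightPart_subset_gap h0 h1)]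
  congr 1
  funext n
  exact Finset.sum_congr rfl fun k _ => Measure.restrict_union (hdisj n k) measurableSet_Ico

/-- A vertical phase space segment: where `F_1` is constantly `c`, the momentum is `y ↦ c - y`. -/
lemma map_prodMk_sub_restrict_Ioo (c p q : ℝ) :
    Measure.map (fun y : ℝ => (c, c - y)) (volume.restrict (Ioo p q)) =
      (Measure.dirac c).prod (volume.restrict (Ioo (c - q) (c - p))) := by
  have hmp := (Measure.measurePreserving_sub_left (volume : Measure ℝ) c).restrict_preimage
    (s := Ioo (c - q) (c - p)) measurableSet_Ioo
  rw [Set.preimage_const_sub_Ioo, sub_sub_cancel, sub_sub_cancel] at hmp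
  rw [Measure.dirac_prod, ← hmp.map_eq, Measure.map_map (by fun_prop) (by fun_prop)]
  rfl

lemma map_leftPart (h0 : 0 < θ) (h1 : θ < 1 / 2) (hk : k < 2 ^ n) :
    Measure.map (fun y => (F θ 1 y, profile θ y)) (volume.restrict (leftPart θ n k)) =
      (Measure.dirac (center θ n k - radius θ n)).prod
        (volume.restrict (Ioo (-((1 - θ) * radius θ n)) 0)) := by
  have hcongr : (fun y => (F θ 1 y, profile θ y)) =ᵐ[volume.restrict (leftPart θ n k)]
      fun y => (center θ n k - radius θ n, center θ n k - radius θ n - y) := by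
    filter_upwards [ae_restrict_mem measurableSet_Ioc] with y hy
    have := F_one_of_mem_leftPart h0 h1 hk hy
    rw [this]
    rw [F_apply] at this
    congr 1
    linarith
  rw [Measure.map_congr hcongr, leftPart, ← restrict_Ioo_eq_restrict_Ioc,
    map_prodMk_sub_restrict_Ioo]
  congr 3 <;> ring

lemma map_rightPart (h0 : 0 < θ) (h1 : θ < 1 / 2) (hk : k < 2 ^ n) :
    Measure.map (fun y => (F θ 1 y, profile θ y)) (volume.restrict (rightPart θ n k)) =
      (Measure.dirac (center θ n k + radius θ n)).prod
        (volume.restrict (Ioo 0 ((1 - θ) * radius θ n))) := by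
  have hcongr : (fun y => (F θ 1 y, profile θ y)) =ᵐ[volume.restrict (rightPart θ n k)]
      fun y => (center θ n k + radius θ n, center θ n k + radius θ n - y) := by
    filter_upwards [ae_restrict_mem measurableSet_Ico] with y hy
    have := F_one_of_mem_rightPart h0 h1 hk hy
    rw [this]
    rw [F_apply] at this
    congr 1
    linarith
  rw [Measure.map_congr hcongr, rightPart, ← Measure.restrict_congr_set Ioo_ae_eq_Ico,
    map_prodMk_sub_restrict_Ioo]
  congr 3 <;> ring

lemma mu_one_eq_map (h0 : 0 < θ) (h1 : θ < 1 / 2) :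
    mu θ 1 = Measure.map (fun y => (F θ 1 y, profile θ y))
      (volume.withDensity fun x => ENNReal.ofReal (density θ x)) := by
  have hU := (continuous_profile h0 h1).measurable
  have hΦ : Measurable (freeFlow 1) := by unfold freeFlow; fun_prop
  rw [mu, transported, muIn, monokinetic, Measure.map_map hΦ (by fun_prop)]
  rfl

lemma mu_one_eq_sum (h0 : 0 < θ) (h1 : θ < 1 / 2) :
    mu θ 1 = ENNReal.ofReal (1 / (1 - θ)) • Measure.sum (fun n : ℕ =>
      ∑ k ∈ Finset.range (2 ^ n),
        ((Measure.dirac (center θ n k - radius θ n)).prod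
            (volume.restrict (Set.Ioo (-((1 - θ) * radius θ n)) 0)) +
          (Measure.dirac (center θ n k + radius θ n)).prod
            (volume.restrict (Set.Ioo 0 ((1 - θ) * radius θ n))))) := by
  have hm : Measurable fun y => (F θ 1 y, profile θ y) :=
    (continuous_F_one h0 h1).measurable.prodMk (continuous_profile h0 h1).measurable
  rw [mu_one_eq_map h0 h1, withDensity_density, Measure.map_smul, restrict_cantorTilde h0 h1,
    Measure.map_sum hm.aemeasurable]
  congr 2
  funext n
  rw [Measure.map_finset_sum hm.aemeasurable]
  refine Finset.sum_congr rfl fun k hk => ?_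
  have hk := Finset.mem_range.1 hk
  rw [Measure.map_add _ _ hm, map_leftPart h0 h1 hk, map_rightPart h0 h1 hk]

lemma rho_one_eq_map (h0 : 0 < θ) (h1 : θ < 1 / 2) :
    rho θ 1 =
      Measure.map (F θ 1) (volume.withDensity fun x => ENNReal.ofReal (density θ x)) := by
  have hm : Measurable fun y => (F θ 1 y, profile θ y) :=
    (continuous_F_one h0 h1).measurable.prodMk (continuous_profile h0 h1).measurable
  rw [rho, mu_one_eq_map h0 h1, Measure.map_map measurable_fst hm]
  rfl

lemma rho_one_eq_sum (h0 : 0 < θ) (h1 : θ < 1 / 2) :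
    rho θ 1 = ENNReal.ofReal ((1 / 2) * (1 - 2 * θ)) • Measure.sum (fun n : ℕ =>
      ENNReal.ofReal (θ ^ n) • ∑ k ∈ Finset.range (2 ^ n),
        (Measure.dirac (center θ n k - radius θ n) +
          Measure.dirac (center θ n k + radius θ n))) := by
  rw [rho, mu_one_eq_sum h0 h1, Measure.map_smul, Measure.map_sum measurable_fst.aemeasurable]
  have hc : ENNReal.ofReal (1 / 2 * (1 - 2 * θ)) =
      ENNReal.ofReal (1 / (1 - θ)) * ENNReal.ofReal ((1 - θ) * (1 / 2 * (1 - 2 * θ))) := by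
    have : 1 - θ ≠ 0 := by linarith
    rw [← ENNReal.ofReal_mul (by rw [one_div_nonneg]; linarith)]
    congr 1
    field_simp
  rw [hc, mul_smul]
  congr 1
  have hsmul : ∀ (c : ℝ≥0∞) (ν : ℕ → Measure ℝ),
      c • Measure.sum ν = Measure.sum fun n => c • ν n := by
    intro c ν
    ext s hs
    simp only [Measure.smul_apply, Measure.sum_apply _ hs, smul_eq_mul, ENNReal.tsum_mul_left]
  rw [hsmul]
  congr 1
  funext n
  rw [Measure.map_finset_sum measurable_fst.aemeasurable, smul_smul, Finset.smul_sum]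
  refine Finset.sum_congr rfl fun k _ => ?_
  have hr : (1 - θ) * radius θ n = (1 - θ) * (1 / 2 * (1 - 2 * θ)) * θ ^ n := by
    unfold radius; ring
  rw [Measure.map_add _ _ measurable_fst, Measure.map_fst_prod, Measure.map_fst_prod,
    Measure.restrict_apply_univ, Measure.restrict_apply_univ, Real.volume_Ioo, Real.volume_Ioo,
    zero_sub, neg_neg, sub_zero, hr, ENNReal.ofReal_mul, smul_add]
  have : 0 ≤ 1 - θ := by linarith
  have : 0 ≤ 1 - 2 * θ := by linarith
  positivity

lemma rho_one_univ (h0 : 0 < θ) (h1 : θ < 1 / 2) : rho θ 1 univ = 1 := by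
  have hv : volume (omegaSet θ) = ENNReal.ofReal θ := by
    have := volume_omegaSet_inter_Ioo h0 h1 (one_mem_cantor h0 h1)
    rw [inter_eq_left.2, ENNReal.ofReal_one, mul_one] at this
    · exact this
    · intro x hx
      have hx' := omegaSet_subset_Icc h0 h1 hx
      have hne := fun y (hy : y ∈ cantor θ) (e : y = x) =>
        Set.disjoint_left.1 (disjoint_cantor_omegaSet h0 h1) hy (e ▸ hx)
      exact ⟨lt_of_le_of_ne hx'.1 (hne 0 (zero_mem_cantor h0 h1)),
        lt_of_le_of_ne hx'.2 fun e => hne 1 (one_mem_cantor h0 h1) e.symm⟩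
  rw [rho_one_eq_map h0 h1, Measure.map_apply (continuous_F_one h0 h1).measurable .univ,
    withDensity_density, preimage_univ, Measure.smul_apply, Measure.restrict_apply_univ,
    cantorTilde, measure_sdiff (omegaSet_subset_Icc h0 h1)
      (isOpen_omegaSet θ).measurableSet.nullMeasurableSet (by simp [hv]), hv, Real.volume_Icc,
    ← ENNReal.ofReal_sub _ h0.le, smul_eq_mul,
    ← ENNReal.ofReal_mul (by rw [one_div_nonneg]; linarith)]
  have : 1 - θ ≠ 0 := by linarith
  rw [sub_zero, one_div_mul_cancel this, ENNReal.ofReal_one]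

lemma rho_one_compl_cantor (h0 : 0 < θ) (h1 : θ < 1 / 2) : rho θ 1 (cantor θ)ᶜ = 0 := by
  have hmeas := (isClosed_cantor h0 h1).measurableSet
  rw [rho_one_eq_map h0 h1, Measure.map_apply (continuous_F_one h0 h1).measurable hmeas.compl,
    withDensity_density, Measure.smul_apply,
    Measure.restrict_apply (hmeas.compl.preimage (continuous_F_one h0 h1).measurable)]
  have : F θ 1 ⁻¹' (cantor θ)ᶜ ∩ cantorTilde θ = ∅ := by
    rw [← disjoint_iff_inter_eq_empty, Set.disjoint_right]
    intro y hy hy'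
    exact hy' (image_F_one_cantorTilde h0 h1 ▸ mem_image_of_mem _ hy)
  rw [this, measure_empty, smul_zero]

lemma rho_one_singleton_pos (h0 : 0 < θ) (h1 : θ < 1 / 2) (hk : k < 2 ^ n) :
    0 < rho θ 1 {center θ n k - radius θ n} := by
  have hm : leftPart θ n k ⊆ F θ 1 ⁻¹' {center θ n k - radius θ n} ∩ cantorTilde θ := by
    intro y hy
    refine ⟨F_one_of_mem_leftPart h0 h1 hk hy, ?_⟩
    rw [cantorTilde_eq h0 h1]
    exact Or.inr (mem_iUnion_of_mem n
      (mem_biUnion (Finset.mem_coe.2 (Finset.mem_range.2 hk)) (Or.inl hy)))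
  have hF := (continuous_F_one h0 h1).measurable
  rw [rho_one_eq_map h0 h1, Measure.map_apply hF (measurableSet_singleton _),
    withDensity_density, Measure.smul_apply,
    Measure.restrict_apply (hF (measurableSet_singleton _))]
  refine ENNReal.mul_pos ?_ (ne_of_gt (lt_of_lt_of_le ?_ (measure_mono hm)))
  · have : 0 < 1 - θ := by linarith
    exact (ENNReal.ofReal_pos.2 (one_div_pos.2 this)).ne'
  · rw [leftPart, Real.volume_Ioc, ENNReal.ofReal_pos]
    linarith [theta_mul_radius_lt h0 h1 n]

/-- Every point of `K(θ)` is a limit of atoms of `ρ(1)`. -/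
lemma support_rho_one (h0 : 0 < θ) (h1 : θ < 1 / 2) : (rho θ 1).support = cantor θ := by
  refine Subset.antisymm (Measure.support_subset_of_isClosed (isClosed_cantor h0 h1)
    (mem_ae_iff.2 (rho_one_compl_cantor h0 h1))) fun x hx => ?_
  rw [Metric.nhds_basis_ball.mem_measureSupport]
  intro ε hε
  obtain ⟨n, hn⟩ := exists_pow_lt_of_lt_one hε (by linarith : θ < 1)
  obtain ⟨k, hk, hxk⟩ := exists_mem_Icc_leftEnd h0 h1 hx n
  refine (rho_one_singleton_pos h0 h1 hk).trans_le (measure_mono (singleton_subset_iff.2 ?_))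
  rw [Metric.mem_ball, Real.dist_eq, center_sub_radius, leftEnd_two_mul]
  have hp := pow_pos h0 (n + 1)
  have hle : θ ^ (n + 1) ≤ θ ^ n := pow_le_pow_of_le_one h0.le (by linarith) (Nat.le_succ n)
  rw [abs_lt]
  constructor <;> linarith [hxk.1, hxk.2]

lemma mutuallySingular_rho_one (h0 : 0 < θ) (h1 : θ < 1 / 2) :
    Measure.MutuallySingular (rho θ 1) volume :=
  ⟨(cantor θ)ᶜ, (isClosed_cantor h0 h1).measurableSet.compl, rho_one_compl_cantor h0 h1, by
    rw [compl_compl, volume_cantor h0 h1]⟩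

/-! ### The caustic fibre -/

/-- Around a point of `K(θ)` the profile oscillates at every scale `θ ^ n`: it vanishes at the
centers of the gaps but has size comparable with `θ ^ n` at the ends of their cores. -/
lemma not_differentiableAt_profile (h0 : 0 < θ) (h1 : θ < 1 / 2) {x : ℝ} (hx : x ∈ cantor θ) :
    ¬ DifferentiableAt ℝ (profile θ) x := by
  intro hd
  set d := deriv (profile θ) x
  have ho := hd.hasDerivAt.isLittleO
  set c : ℝ := (1 - θ) * (1 / 2 * (1 - 2 * θ)) with hc
  have hcpos : 0 < c := mul_pos (by linarith) (by linarith)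
  -- `c * θ ^ n` is the size of the profile at the ends of the cores of generation `n`; the linear
  -- approximation is used with the tolerance `c / 4`.
  obtain ⟨δ, hδ, hb⟩ := Metric.eventually_nhds_iff.1 (ho.def (by positivity : 0 < c / 4))
  obtain ⟨n, hn⟩ := exists_pow_lt_of_lt_one hδ (by linarith : θ < 1)
  obtain ⟨k, hk, hxk⟩ := exists_mem_Icc_leftEnd h0 h1 hx n
  have hr := radius_pos h0 h1 n
  have hlt := theta_mul_radius_lt h0 h1 n
  have hθr : 0 < θ * radius θ n := mul_pos h0 hr
  have hdist : ∀ y ∈ gap θ n k, |y - x| ≤ θ ^ n := by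
    intro y hy
    have := gap_subset_Icc_leftEnd h0 n k hy
    rw [abs_le]
    constructor <;> linarith [this.1, this.2, hxk.1, hxk.2]
  have hbound : ∀ y ∈ gap θ n k, |profile θ y - (y - x) * d| ≤ c / 4 * |y - x| := by
    intro y hy
    have := hb (y := y) (by rw [Real.dist_eq]; exact (hdist y hy).trans_lt hn)
    rwa [profile_of_mem_cantor h0 h1 hx, sub_zero, smul_eq_mul, Real.norm_eq_abs,
      Real.norm_eq_abs] at this
  have hy : center θ n k ∈ gap θ n k := ⟨by linarith, by linarith⟩
  have hz : center θ n k - θ * radius θ n ∈ gap θ n k := ⟨by linarith, by linarith⟩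
  have hUy : profile θ (center θ n k) = 0 := by
    have := F_one_core (y := center θ n k) h0 h1 hk ⟨by linarith, by linarith⟩
    rw [F_apply, sub_self, zero_div] at this
    linarith
  have hUz : profile θ (center θ n k - θ * radius θ n) = -(c * θ ^ n) := by
    have := F_one_core_left (y := center θ n k - θ * radius θ n) h0 h1 hk ⟨by linarith, le_rfl⟩
    have e : c * θ ^ n = (1 - θ) * radius θ n := by rw [hc, radius]; ring
    rw [F_apply] at this
    rw [e]
    linarith
  -- The center of the gap is a zero of the profile other than `x`, so the derivative is small.
  have hdsmall : |d| ≤ c / 4 := by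
    have hne : 0 < |center θ n k - x| := by
      rw [abs_pos, sub_ne_zero]
      rintro e
      exact Set.disjoint_left.1 (disjoint_gap_cantor hk) hy (e ▸ hx)
    have := hbound _ hy
    rw [hUy, zero_sub, abs_neg, abs_mul, mul_comm] at this
    exact le_of_mul_le_mul_right this hne
  have h2 := hbound _ hz
  have h3 := hdist _ hz
  have hp := pow_pos h0 n
  rw [hUz] at h2
  set w := center θ n k - θ * radius θ n - x
  have h4 : |w * d| ≤ c / 4 * θ ^ n := by
    rw [abs_mul, mul_comm]
    exact mul_le_mul hdsmall h3 (abs_nonneg _) (by positivity)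
  have h5 := (abs_le.1 h2).1
  have h6 : c / 4 * |w| ≤ c / 4 * θ ^ n := mul_le_mul_of_nonneg_left h3 (by positivity)
  have h7 := (abs_le.1 h4).1
  have : 0 < c * θ ^ n := mul_pos hcpos hp
  linarith

/-- Off `K̃(θ)` the map `F_1` is locally affine with slope `1` or `1 / θ`. -/
lemma exists_hasDerivAt_F_one (h0 : 0 < θ) (h1 : θ < 1 / 2) {y : ℝ} (hy : y ∉ cantorTilde θ) :
    ∃ c ≠ 0, HasDerivAt (F θ 1) c y := by
  by_cases hI : y ∈ Icc (0 : ℝ) 1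
  · have ho : y ∈ omegaSet θ := by by_contra h; exact hy ⟨hI, h⟩
    obtain ⟨n, k, hk, hyk⟩ := mem_omegaSet.1 ho
    refine ⟨1 / θ, by positivity, ?_⟩
    have : HasDerivAt (fun y => center θ n k + (y - center θ n k) / θ) (1 / θ) y :=
      (((hasDerivAt_id y).sub_const _).div_const θ).const_add _
    refine this.congr_of_eventuallyEq ?_
    filter_upwards [isOpen_Ioo.mem_nhds hyk] with z hz
    exact F_one_core h0 h1 hk (Ioo_subset_Icc_self hz)
  · refine ⟨1, one_ne_zero, (hasDerivAt_id y).congr_of_eventuallyEq ?_⟩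
    filter_upwards [isClosed_Icc.isOpen_compl.mem_nhds hI] with z hz
    exact F_one_of_notMem_Icc hz

lemma caustic_one (h0 : 0 < θ) (h1 : θ < 1 / 2) : caustic θ 1 = cantor θ := by
  refine Subset.antisymm ?_ fun x hx =>
    ⟨x, F_one_of_mem_cantor h0 h1 hx, Or.inr (not_differentiableAt_profile h0 h1 hx)⟩
  rintro x ⟨y, rfl, hy⟩
  change F θ 1 y ∈ cantor θ
  rw [← image_F_one_cantorTilde h0 h1]
  refine mem_image_of_mem _ ?_
  by_contra hyt
  obtain ⟨c, hc, hd⟩ := exists_hasDerivAt_F_one h0 h1 hyt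
  rcases hy with hy | hy
  · exact hc (hd.deriv ▸ abs_eq_zero.1 hy.2)
  · refine hy ?_
    have e : profile θ = fun z => F θ 1 z - z := by funext z; rw [F_apply]; ring
    rw [e]
    exact hd.differentiableAt.sub differentiableAt_id

/-! ### The Cantor function -/

/-- The `n`-th iterate, started at the clamped identity, of the operator whose fixed point is the
Cantor function of `K(θ)`. For `θ < 1 / 2` the two summands are never both non-constant
near a point. -/
noncomputable def cantorApprox (θ : ℝ) : ℕ → ℝ → ℝ
  | 0, x => max 0 (min 1 x)
  | n + 1, x => (cantorApprox θ n (x / θ) + cantorApprox θ n ((x - (1 - θ)) / θ)) / 2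

lemma cantorApprox_zero (θ x : ℝ) : cantorApprox θ 0 x = max 0 (min 1 x) := rfl

lemma cantorApprox_succ (θ : ℝ) (n : ℕ) (x : ℝ) : cantorApprox θ (n + 1) x =
    (cantorApprox θ n (x / θ) + cantorApprox θ n ((x - (1 - θ)) / θ)) / 2 := rfl

lemma cantorApprox_of_nonpos (h0 : 0 < θ) (h1 : θ < 1 / 2) (n : ℕ) :
    ∀ x ≤ 0, cantorApprox θ n x = 0 := by
  induction n with
  | zero => intro x hx; simp [cantorApprox, hx]
  | succ n ih =>
    intro x hx
    rw [cantorApprox_succ, ih _ (div_nonpos_of_nonpos_of_nonneg hx h0.le),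
      ih _ (div_nonpos_of_nonpos_of_nonneg (by linarith) h0.le)]
    norm_num

lemma cantorApprox_of_one_le (h0 : 0 < θ) (h1 : θ < 1 / 2) (n : ℕ) :
    ∀ x, 1 ≤ x → cantorApprox θ n x = 1 := by
  induction n with
  | zero => intro x hx; simp [cantorApprox, hx]
  | succ n ih =>
    intro x hx
    rw [cantorApprox_succ, ih _ (by rw [le_div_iff₀ h0]; linarith),
      ih _ (by rw [le_div_iff₀ h0]; linarith)]
    norm_num

lemma abs_cantorApprox_succ_sub_le (h0 : 0 < θ) (h1 : θ < 1 / 2) (n : ℕ) :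
    ∀ x, |cantorApprox θ (n + 1) x - cantorApprox θ n x| ≤ (1 / 2) ^ n := by
  induction n with
  | zero =>
    intro x
    have hb : ∀ y, 0 ≤ cantorApprox θ 0 y ∧ cantorApprox θ 0 y ≤ 1 := fun y =>
      ⟨le_max_left _ _, max_le zero_le_one (min_le_left _ _)⟩
    rw [cantorApprox_succ, pow_zero, abs_le]
    have a := hb x
    have b := hb (x / θ)
    have c := hb ((x - (1 - θ)) / θ)
    constructor <;> linarith [a.1, a.2, b.1, b.2, c.1, c.2]
  | succ n ih =>
    intro x
    rw [cantorApprox_succ θ (n + 1), cantorApprox_succ θ n x, pow_succ]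
    rcases le_total x (1 / 2) with hx | hx
    · have hy : (x - (1 - θ)) / θ ≤ 0 := div_nonpos_of_nonpos_of_nonneg (by linarith) h0.le
      rw [cantorApprox_of_nonpos h0 h1 _ _ hy, cantorApprox_of_nonpos h0 h1 _ _ hy]
      have := abs_le.1 (ih (x / θ))
      rw [abs_le]
      constructor <;> linarith [this.1, this.2]
    · have hy : 1 ≤ x / θ := by rw [le_div_iff₀ h0]; linarith
      rw [cantorApprox_of_one_le h0 h1 _ _ hy, cantorApprox_of_one_le h0 h1 _ _ hy]
      have := abs_le.1 (ih ((x - (1 - θ)) / θ))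
      rw [abs_le]
      constructor <;> linarith [this.1, this.2]

lemma div_rpow_eq_two_mul_rpow (h0 : 0 < θ) (hθs : θ ^ s = 1 / 2) {t : ℝ} (ht : 0 ≤ t) :
    (t / θ) ^ s = 2 * t ^ s := by
  rw [Real.div_rpow ht h0.le, hθs]; ring

/-- The inequality that makes the Hölder constant of the Cantor function equal to `1`: replacing an
interval that spans the central gap by its parts on both sides of the gap does not increase the
sum of the lengths to the power `s`. -/
lemma rpow_add_rpow_le (hs : s ∈ Ioo (0 : ℝ) 1) (h0 : 0 < θ) (h1 : θ < 1 / 2)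
    (hθs : θ ^ s = 1 / 2) {u v : ℝ} (hu : u ∈ Icc 0 θ) (hv : v ∈ Icc 0 θ) :
    u ^ s + v ^ s ≤ (u + v + (1 - 2 * θ)) ^ s := by
  have hconc := (Real.concaveOn_rpow hs.1.le hs.2.le).2 (mem_Ici.2 hu.1) (mem_Ici.2 hv.1)
    (by norm_num : (0 : ℝ) ≤ 1 / 2) (by norm_num : (0 : ℝ) ≤ 1 / 2) (by norm_num)
  simp only [smul_eq_mul] at hconc
  set w := 1 / 2 * u + 1 / 2 * v with hw
  have hw0 : 0 ≤ w := by linarith [hu.1, hv.1]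
  have hwθ : w ≤ θ := by linarith [hu.2, hv.2]
  have h2 : (w / θ) ^ s = 2 * w ^ s := div_rpow_eq_two_mul_rpow h0 hθs hw0
  have h3 : w / θ ≤ u + v + (1 - 2 * θ) := by
    rw [div_le_iff₀ h0]
    have : u + v = 2 * w := by rw [hw]; ring
    rw [this]
    nlinarith [mul_nonneg (sub_nonneg.2 hwθ) (by linarith : (0 : ℝ) ≤ 1 - 2 * θ)]
  have h4 := Real.rpow_le_rpow (div_nonneg hw0 h0.le) h3 hs.1.le
  linarith

lemma cantorApprox_clamp (h0 : 0 < θ) (h1 : θ < 1 / 2) (n : ℕ) (x : ℝ) :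
    cantorApprox θ n (max 0 (min 1 x)) = cantorApprox θ n x := by
  rcases le_total x 0 with hx | hx
  · rw [min_eq_right (by linarith), max_eq_left hx, cantorApprox_of_nonpos h0 h1 n x hx,
      cantorApprox_of_nonpos h0 h1 n 0 le_rfl]
  · rcases le_total x 1 with hx' | hx'
    · rw [min_eq_right hx', max_eq_right hx]
    · rw [min_eq_left hx', max_eq_right zero_le_one, cantorApprox_of_one_le h0 h1 n x hx',
        cantorApprox_of_one_le h0 h1 n 1 le_rfl]

lemma clamp_sub_clamp_le {x y : ℝ} (hxy : x ≤ y) :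
    max 0 (min 1 x) ≤ max 0 (min 1 y) ∧ max 0 (min 1 y) - max 0 (min 1 x) ≤ y - x := by
  constructor
  · gcongr
  · rcases le_total x 0 with h | h <;> rcases le_total y 0 with h' | h' <;>
    rcases le_total x 1 with h2 | h2 <;> rcases le_total y 1 with h3 | h3 <;>
    simp [*] <;> linarith

/-- The self-similar step: the Hölder bound passes to the next approximation. -/
lemma cantorApprox_sub_le (hs : s ∈ Ioo (0 : ℝ) 1) (h0 : 0 < θ) (h1 : θ < 1 / 2)
    (hθs : θ ^ s = 1 / 2) (n : ℕ) :
    ∀ x y, x ≤ y → cantorApprox θ n x ≤ cantorApprox θ n y ∧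
      cantorApprox θ n y - cantorApprox θ n x ≤ (y - x) ^ s := by
  induction n with
  | zero =>
    intro x y hxy
    refine ⟨(clamp_sub_clamp_le hxy).1, ?_⟩
    have ha := (clamp_sub_clamp_le hxy).2
    have hb : max 0 (min 1 y) - max 0 (min 1 x) ≤ 1 := by
      have : max 0 (min 1 y) ≤ 1 := max_le zero_le_one (min_le_left _ _)
      have : 0 ≤ max 0 (min 1 x) := le_max_left _ _
      linarith
    rw [cantorApprox_zero, cantorApprox_zero]
    rcases le_total (y - x) 1 with h | h
    · exact ha.trans (Real.self_le_rpow_of_le_one (sub_nonneg.2 hxy) h hs.2.le)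
    · exact hb.trans (Real.one_le_rpow h hs.1.le)
  | succ n ih =>
    intro x y hxy
    have hxy1 : x / θ ≤ y / θ := by gcongr
    have hxy2 : (x - (1 - θ)) / θ ≤ (y - (1 - θ)) / θ := by gcongr
    constructor
    · rw [cantorApprox_succ, cantorApprox_succ]
      linarith [(ih _ _ hxy1).1, (ih _ _ hxy2).1]
    -- Clamping to `[0, 1]` does not change the values and does not increase the distance.
    suffices key : ∀ x y, 0 ≤ x → y ≤ 1 → x ≤ y →
        cantorApprox θ (n + 1) y - cantorApprox θ (n + 1) x ≤ (y - x) ^ s by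
      have hc := clamp_sub_clamp_le hxy
      rw [← cantorApprox_clamp h0 h1 (n + 1) x, ← cantorApprox_clamp h0 h1 (n + 1) y]
      exact (key _ _ (le_max_left _ _) (max_le zero_le_one (min_le_left _ _)) hc.1).trans
        (Real.rpow_le_rpow (sub_nonneg.2 hc.1) hc.2 hs.1.le)
    clear hxy hxy1 hxy2 x y
    intro x y hx hy hxy
    rw [cantorApprox_succ, cantorApprox_succ]
    rcases le_total y (1 - θ) with hy' | hy'
    · have hy2 : (y - (1 - θ)) / θ ≤ 0 := div_nonpos_of_nonpos_of_nonneg (by linarith) h0.le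
      have hx2 : (x - (1 - θ)) / θ ≤ 0 := div_nonpos_of_nonpos_of_nonneg (by linarith) h0.le
      have := (ih (x / θ) (y / θ) (by gcongr)).2
      rw [← sub_div, div_rpow_eq_two_mul_rpow h0 hθs (sub_nonneg.2 hxy)] at this
      rw [cantorApprox_of_nonpos h0 h1 _ _ hy2, cantorApprox_of_nonpos h0 h1 _ _ hx2]
      linarith
    rcases le_total θ x with hx' | hx'
    · have hy2 : 1 ≤ y / θ := by rw [le_div_iff₀ h0]; linarith
      have hx2 : 1 ≤ x / θ := by rw [le_div_iff₀ h0]; linarith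
      have := (ih ((x - (1 - θ)) / θ) ((y - (1 - θ)) / θ) (by gcongr)).2
      rw [← sub_div, sub_sub_sub_cancel_right,
        div_rpow_eq_two_mul_rpow h0 hθs (sub_nonneg.2 hxy)] at this
      rw [cantorApprox_of_one_le h0 h1 _ _ hy2, cantorApprox_of_one_le h0 h1 _ _ hx2]
      linarith
    -- Here `x` lies in the left copy and `y` in the right copy.
    · have hy2 : 1 ≤ y / θ := by rw [le_div_iff₀ h0]; linarith
      have hx2 : (x - (1 - θ)) / θ ≤ 0 := div_nonpos_of_nonpos_of_nonneg (by linarith) h0.le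
      have a := (ih (x / θ) 1 (by rw [div_le_iff₀ h0]; linarith)).2
      have b := (ih 0 ((y - (1 - θ)) / θ) (div_nonneg (by linarith) h0.le)).2
      have e : 1 - x / θ = (θ - x) / θ := by field_simp
      rw [e, div_rpow_eq_two_mul_rpow h0 hθs (by linarith),
        cantorApprox_of_one_le h0 h1 _ 1 le_rfl] at a
      rw [sub_zero, div_rpow_eq_two_mul_rpow h0 hθs (by linarith),
        cantorApprox_of_nonpos h0 h1 _ 0 le_rfl] at b
      rw [cantorApprox_of_one_le h0 h1 _ _ hy2, cantorApprox_of_nonpos h0 h1 _ _ hx2]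
      have hc := rpow_add_rpow_le hs h0 h1 hθs (u := θ - x) (v := y - (1 - θ))
        ⟨by linarith, by linarith⟩ ⟨by linarith, by linarith⟩
      have e2 : θ - x + (y - (1 - θ)) + (1 - 2 * θ) = y - x := by ring
      rw [e2] at hc
      linarith

/-- The Cantor function of `K(θ)`: it halves on both similar copies of `K(θ)` and is Hölder
continuous of exponent `s` with constant `1`. -/
lemma exists_cantorFunction (hs : s ∈ Ioo (0 : ℝ) 1) (h0 : 0 < θ) (h1 : θ < 1 / 2)
    (hθs : θ ^ s = 1 / 2) : ∃ G : ℝ → ℝ, G 0 = 0 ∧ G 1 = 1 ∧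
      (∀ x ∈ Icc (0 : ℝ) 1, G (θ * x) = G x / 2 ∧ G (θ * x + (1 - θ)) = 1 / 2 + G x / 2) ∧
      ∀ x y, |G x - G y| ≤ |x - y| ^ s := by
  have hlim : ∀ x, ∃ g, Filter.Tendsto (fun n => cantorApprox θ n x) Filter.atTop (nhds g) := by
    intro x
    refine cauchySeq_tendsto_of_complete
      (cauchySeq_of_le_geometric (1 / 2) 1 (by norm_num) fun n => ?_)
    rw [dist_comm, Real.dist_eq, one_mul]
    exact abs_cantorApprox_succ_sub_le h0 h1 n x
  choose G hG using hlim
  have hG0 : ∀ x ≤ 0, G x = 0 := fun x hx => tendsto_nhds_unique (hG x) (by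
    simp only [cantorApprox_of_nonpos h0 h1 _ x hx]; exact tendsto_const_nhds)
  have hG1 : ∀ x, 1 ≤ x → G x = 1 := fun x hx => tendsto_nhds_unique (hG x) (by
    simp only [cantorApprox_of_one_le h0 h1 _ x hx]; exact tendsto_const_nhds)
  have hfix : ∀ x, G x = (G (x / θ) + G ((x - (1 - θ)) / θ)) / 2 := fun x =>
    tendsto_nhds_unique ((hG x).comp (Filter.tendsto_add_atTop_nat 1))
      (((hG _).add (hG _)).div_const 2)
  have hle : ∀ x y, x ≤ y → |G y - G x| ≤ |y - x| ^ s := by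
    intro x y hxy
    have a := ge_of_tendsto' ((hG y).sub (hG x)) (b := 0) fun n =>
      sub_nonneg.2 (cantorApprox_sub_le hs h0 h1 hθs n x y hxy).1
    have b := le_of_tendsto' ((hG y).sub (hG x)) fun n =>
      (cantorApprox_sub_le hs h0 h1 hθs n x y hxy).2
    rwa [abs_of_nonneg a, abs_of_nonneg (sub_nonneg.2 hxy)]
  refine ⟨G, hG0 0 le_rfl, hG1 1 le_rfl, fun x hx => ⟨?_, ?_⟩, fun x y => ?_⟩
  · have hθx : θ * x ≤ θ := mul_le_of_le_one_right h0.le hx.2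
    rw [hfix (θ * x), mul_div_cancel_left₀ _ h0.ne',
      hG0 _ (div_nonpos_of_nonpos_of_nonneg (by linarith) h0.le), add_zero]
  · have hθx : 0 ≤ θ * x := mul_nonneg h0.le hx.1
    rw [hfix (θ * x + (1 - θ)), add_sub_cancel_right, mul_div_cancel_left₀ _ h0.ne',
      hG1 _ (by rw [le_div_iff₀ h0]; linarith)]
    ring
  · rcases le_total x y with h | h
    · rw [abs_sub_comm, abs_sub_comm x]; exact hle x y h
    · exact hle y x h

/-! ### Hausdorff measure of the Cantor set -/

/-- Segments are numbered by binary digits; the leading digit selects one of the two similar copies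
of the previous stage. -/
lemma leftEnd_succ_eq (θ : ℝ) (n : ℕ) : ∀ k < 2 ^ n,
    leftEnd θ (n + 1) k = θ * leftEnd θ n k ∧
      leftEnd θ (n + 1) (2 ^ n + k) = θ * leftEnd θ n k + (1 - θ) := by
  induction n with
  | zero =>
    intro k hk
    obtain rfl : k = 0 := by simpa using hk
    simp [leftEnd]
  | succ n ih =>
    intro k hk
    have hk2 : k / 2 < 2 ^ n := by rw [pow_succ] at hk; omega
    have hdiv : (2 ^ (n + 1) + k) / 2 = 2 ^ n + k / 2 := by rw [pow_succ]; omega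
    have hmod : (2 ^ (n + 1) + k) % 2 = k % 2 := by rw [pow_succ]; omega
    have e : ∀ m i, leftEnd θ (m + 1) i =
      leftEnd θ m (i / 2) + (if i % 2 = 0 then 0 else (1 - θ) * θ ^ m) := fun _ _ => rfl
    rw [e (n + 1) k, e (n + 1), hdiv, hmod, (ih _ hk2).1, (ih _ hk2).2, e n k, pow_succ]
    constructor <;> split_ifs <;> ring

lemma mem_stage_succ (h0 : 0 < θ) (h1 : θ < 1 / 2) {x : ℝ} (hx : x ∈ stage θ n) :
    θ * x ∈ stage θ (n + 1) ∧ θ * x + (1 - θ) ∈ stage θ (n + 1) := by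
  rw [stage_eq h0 h1] at hx
  simp only [mem_iUnion, Finset.mem_range] at hx
  obtain ⟨k, hk, hx⟩ := hx
  obtain ⟨e1, e2⟩ := leftEnd_succ_eq θ n k hk
  have hl := mul_le_mul_of_nonneg_left hx.1 h0.le
  have hu := mul_le_mul_of_nonneg_left hx.2 h0.le
  rw [mul_add, ← pow_succ'] at hu
  constructor
  · refine Icc_leftEnd_subset_stage (k := k) h0 h1 (by rw [pow_succ]; omega) ?_
    rw [e1]; exact ⟨hl, hu⟩
  · refine Icc_leftEnd_subset_stage (k := 2 ^ n + k) h0 h1 (by rw [pow_succ]; omega) ?_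
    rw [e2]; exact ⟨by linarith, by linarith⟩

lemma one_le_hausdorffMeasure_cantor (hs : s ∈ Ioo (0 : ℝ) 1) (h0 : 0 < θ) (h1 : θ < 1 / 2)
    (hθs : θ ^ s = 1 / 2) : 1 ≤ Measure.hausdorffMeasure s (cantor θ) := by
  obtain ⟨G, hG0, hG1, hGs, hGh⟩ := exists_cantorFunction hs h0 h1 hθs
  have hs' : (s.toNNReal : ℝ) = s := Real.coe_toNNReal s hs.1.le
  have hpos : 0 < s.toNNReal := Real.toNNReal_pos.2 hs.1
  have hH : HolderWith 1 s.toNNReal G := by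
    intro x y
    rw [ENNReal.coe_one, one_mul, edist_dist, edist_dist, hs',
      ENNReal.ofReal_rpow_of_nonneg dist_nonneg hs.1.le]
    exact ENNReal.ofReal_le_ofReal (hGh x y)
  have hc : Continuous G := hH.continuous hpos
  -- `G` maps every stage onto `[0, 1]`; compactness passes this on to the intersection.
  have hstage : ∀ n, ∀ t ∈ Icc (0 : ℝ) 1, ∃ x ∈ stage θ n, G x = t := by
    intro n
    induction n with
    | zero =>
      intro t ht
      exact intermediate_value_Icc zero_le_one hc.continuousOn (by rwa [hG0, hG1])
    | succ n ih =>
      intro t ht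
      rcases le_total t (1 / 2) with h | h
      · obtain ⟨x, hx, e⟩ := ih (2 * t) ⟨by linarith [ht.1], by linarith⟩
        refine ⟨_, (mem_stage_succ h0 h1 hx).1, ?_⟩
        rw [(hGs x (stage_antitone θ (Nat.zero_le n) hx)).1, e]
        ring
      · obtain ⟨x, hx, e⟩ := ih (2 * t - 1) ⟨by linarith, by linarith [ht.2]⟩
        refine ⟨_, (mem_stage_succ h0 h1 hx).2, ?_⟩
        rw [(hGs x (stage_antitone θ (Nat.zero_le n) hx)).2, e]
        ring
  have himage : Icc (0 : ℝ) 1 ⊆ G '' cantor θ := by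
    intro t ht
    have hcl : IsClosed (G ⁻¹' {t}) := isClosed_singleton.preimage hc
    have hne : (⋂ n, stage θ n ∩ G ⁻¹' {t}).Nonempty :=
      IsCompact.nonempty_iInter_of_sequence_nonempty_isCompact_isClosed _
        (fun n => inter_subset_inter_left _ (stage_antitone θ (Nat.le_succ n)))
        (fun n => hstage n t ht)
        (isCompact_Icc.inter_right hcl)
        fun n => (isClosed_stage h0 h1 n).inter hcl
    obtain ⟨x, hx⟩ := hne
    rw [mem_iInter] at hx
    exact ⟨x, mem_iInter.2 fun n => (hx n).1, (hx 0).2⟩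
  have hle := (hH.holderOnWith (cantor θ)).hausdorffMeasure_image_le hpos (zero_le_one (α := ℝ))
  rw [hausdorffMeasure_real, mul_one, hs'] at hle
  calc (1 : ℝ≥0∞) = volume (Icc (0 : ℝ) 1) := by simp
    _ ≤ volume (G '' cantor θ) := measure_mono himage
    _ ≤ _ := by simpa using hle

lemma hausdorffMeasure_cantor_le_one (hs : s ∈ Ioo (0 : ℝ) 1) (h0 : 0 < θ) (h1 : θ < 1 / 2)
    (hθs : θ ^ s = 1 / 2) : Measure.hausdorffMeasure s (cantor θ) ≤ 1 := by
  have hediam : ∀ n (i : Fin (2 ^ n)),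
      Metric.ediam (Icc (leftEnd θ n i) (leftEnd θ n i + θ ^ n)) = ENNReal.ofReal (θ ^ n) := by
    intro n i
    rw [Real.ediam_Icc, add_sub_cancel_left]
  have hr : Filter.Tendsto (fun n : ℕ => ENNReal.ofReal (θ ^ n)) Filter.atTop (nhds 0) := by
    rw [← ENNReal.ofReal_zero]
    exact ENNReal.tendsto_ofReal (tendsto_pow_atTop_nhds_zero_of_lt_one h0.le (by linarith))
  have hle := Measure.hausdorffMeasure_le_liminf_sum (ι := fun n : ℕ => Fin (2 ^ n)) s (cantor θ)
    _ hr (fun n i => Icc (leftEnd θ n i) (leftEnd θ n i + θ ^ n))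
    (Filter.Eventually.of_forall fun n i => (hediam n i).le)
    (Filter.Eventually.of_forall fun n x hx => by
      obtain ⟨k, hk, hxk⟩ := exists_mem_Icc_leftEnd h0 h1 hx n
      exact mem_iUnion_of_mem (⟨k, hk⟩ : Fin (2 ^ n)) hxk)
  refine hle.trans (le_of_eq ?_)
  have hsum : ∀ n : ℕ, ∑ i : Fin (2 ^ n),
      Metric.ediam (Icc (leftEnd θ n i) (leftEnd θ n i + θ ^ n)) ^ s = 1 := by
    intro n
    have hpow : (θ ^ n) ^ s = (1 / 2) ^ n := by
      rw [← Real.rpow_natCast, ← Real.rpow_mul h0.le, mul_comm, Real.rpow_mul h0.le, hθs,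
        Real.rpow_natCast]
    simp only [hediam, Finset.sum_const, Finset.card_univ, Fintype.card_fin]
    rw [ENNReal.ofReal_rpow_of_nonneg (by positivity) hs.1.le, hpow, nsmul_eq_mul,
      ← ENNReal.ofReal_natCast, ← ENNReal.ofReal_mul (by positivity)]
    push_cast
    rw [← mul_pow]
    norm_num
  simp only [hsum]
  exact Filter.liminf_const 1

lemma hausdorffMeasure_cantor (hs : s ∈ Ioo (0 : ℝ) 1) (h0 : 0 < θ) (h1 : θ < 1 / 2)
    (hθs : θ ^ s = 1 / 2) : Measure.hausdorffMeasure s (cantor θ) = 1 :=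
  le_antisymm (hausdorffMeasure_cantor_le_one hs h0 h1 hθs)
    (one_le_hausdorffMeasure_cantor hs h0 h1 hθs)

lemma dimH_cantor (hs : s ∈ Ioo (0 : ℝ) 1) (h0 : 0 < θ) (h1 : θ < 1 / 2)
    (hθs : θ ^ s = 1 / 2) : dimH (cantor θ) = ENNReal.ofReal s := by
  have h := hausdorffMeasure_cantor hs h0 h1 hθs
  have hs' : (s.toNNReal : ℝ) = s := Real.coe_toNNReal s hs.1.le
  exact dimH_of_hausdorffMeasure_ne_zero_ne_top (by rw [hs', h]; simp) (by rw [hs', h]; simp)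

/-! ### The exponent and the contraction ratio -/

lemma theta_pos (hθ : θ = (2 : ℝ) ^ (-1 / s)) : 0 < θ := hθ ▸ Real.rpow_pos_of_pos two_pos _

lemma theta_rpow (hs : s ∈ Ioo (0 : ℝ) 1) (hθ : θ = (2 : ℝ) ^ (-1 / s)) : θ ^ s = 1 / 2 := by
  rw [hθ, ← Real.rpow_mul two_pos.le, div_mul_cancel₀ _ hs.1.ne', Real.rpow_neg_one]
  norm_num

lemma theta_lt_half (hs : s ∈ Ioo (0 : ℝ) 1) (hθ : θ = (2 : ℝ) ^ (-1 / s)) : θ < 1 / 2 := by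
  have h : (1 : ℝ) / 2 = 2 ^ (-1 : ℝ) := by rw [Real.rpow_neg_one]; norm_num
  rw [hθ, h]
  refine Real.rpow_lt_rpow_of_exponent_lt one_lt_two ?_
  rw [div_lt_iff₀ hs.1]
  linarith [hs.2]

lemma eq_log_two_div_log (hs : s ∈ Ioo (0 : ℝ) 1) (hθ : θ = (2 : ℝ) ^ (-1 / s)) :
    s = Real.log 2 / Real.log (1 / θ) := by
  have hl : Real.log 2 ≠ 0 := (Real.log_pos one_lt_two).ne'
  have hs0 := hs.1.ne'
  rw [one_div, Real.log_inv, hθ, Real.log_rpow two_pos]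
  field_simp

end CantorCaustic

theorem mainTheorem8 (s θ : ℝ) (hs : s ∈ Set.Ioo (0 : ℝ) 1) (hθ : θ = (2 : ℝ) ^ (-1 / s)) :
    -- the setting: free flow, Lipschitz profile supported in `[0, 1]`
    IsHamiltonianFlow freeHamiltonian freeFlow ∧
    (∃ L : ℝ≥0, LipschitzWith L (profile θ)) ∧
    tsupport (profile θ) ⊆ Set.Icc 0 1 ∧
    (∀ t y : ℝ, F θ t y = y + t * profile θ y) ∧
    -- (a) monotonicity of `F_1`
    StrictMonoOn (F θ 1) (Set.Iio 0 ∪ omegaSet θ ∪ Set.Ioi 1) ∧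
    Monotone (F θ 1) ∧
    -- (b) images under `F_1`
    F θ 1 '' (Set.Iio 0 ∪ omegaSet θ ∪ Set.Ioi 1) = (cantor θ)ᶜ ∧
    F θ 1 '' cantorTilde θ = cantor θ ∧
    -- (c) the phase space measure at time `1`
    mu θ 1 = ENNReal.ofReal (1 / (1 - θ)) • Measure.sum (fun n : ℕ =>
      ∑ k ∈ Finset.range (2 ^ n),
        ((Measure.dirac (center θ n k - radius θ n)).prod
            (volume.restrict (Set.Ioo (-((1 - θ) * radius θ n)) 0)) +
          (Measure.dirac (center θ n k + radius θ n)).prod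
            (volume.restrict (Set.Ioo 0 ((1 - θ) * radius θ n))))) ∧
    -- (d) its first marginal
    rho θ 1 = Measure.map (F θ 1) (volume.withDensity fun x => ENNReal.ofReal (density θ x)) ∧
    rho θ 1 = ENNReal.ofReal ((1 / 2) * (1 - 2 * θ)) • Measure.sum (fun n : ℕ =>
      ENNReal.ofReal (θ ^ n) • ∑ k ∈ Finset.range (2 ^ n),
        (Measure.dirac (center θ n k - radius θ n) +
          Measure.dirac (center θ n k + radius θ n))) ∧
    rho θ 1 Set.univ = 1 ∧
    (rho θ 1).support = cantor θ ∧
    Measure.MutuallySingular (rho θ 1) volume ∧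
    -- (e) the caustic fibre at time `1`
    caustic θ 1 ∩ Set.Ioo 0 1 = cantor θ ∩ Set.Ioo 0 1 ∧
    Measure.hausdorffMeasure s (caustic θ 1) = 1 ∧
    Measure.hausdorffMeasure s (cantor θ) = 1 ∧
    s = Real.log 2 / Real.log (1 / θ) ∧
    dimH (caustic θ 1) = ENNReal.ofReal s ∧
    dimH (rho θ 1).support = ENNReal.ofReal s := by
  have h0 := theta_pos hθ
  have h1 := theta_lt_half hs hθ
  have hθs := theta_rpow hs hθ
  have hH := hausdorffMeasure_cantor hs h0 h1 hθs
  have hdim := dimH_cantor hs h0 h1 hθs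
  have hC := caustic_one h0 h1
  have hsupp := support_rho_one h0 h1
  exact ⟨isHamiltonianFlow_freeFlow, exists_lipschitzWith_profile h0 h1,
    tsupport_profile_subset θ, F_apply θ, strictMonoOn_F_one h0 h1, monotone_F_one h0 h1,
    image_F_one_eq_compl_cantor h0 h1, image_F_one_cantorTilde h0 h1, mu_one_eq_sum h0 h1,
    rho_one_eq_map h0 h1, rho_one_eq_sum h0 h1, rho_one_univ h0 h1, hsupp,
    mutuallySingular_rho_one h0 h1, by rw [hC], by rw [hC, hH], hH, eq_log_two_div_log hs hθ,
    by rw [hC, hdim], by rw [hsupp, hdim]⟩
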